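/- Let $\mathbb D\in\{\mathbb R,\mathbb T\}$ with $\mathbb T=\mathbb R/2\pi\mathbb Z$, and let $V,f\colon\mathbb D^d\to\mathbb R$ be smooth, with $\mathrm e^{-V}$ Lebesgue integrable, $Z=\int_{\mathbb D^d}\mathrm e^{-V}$, $\mu=Z^{-1}\mathrm e^{-V}\,\mathrm dx$, $f\in L^1(\mu)$ not $\mu$-almost everywhere constant, and $I=\int f\,\mathrm d\mu$. For a function $U$ on $\mathbb D^d$ put $Z[U]=\int_{\mathbb D^d}\mathrm e^{-V-U}$ and $\mu_U=Z[U]^{-1}\mathrm e^{-V-U}\,\mathrm dx$. Let $H^1(\mu_U)$ be the set of $\varphi\in L^2(\mu_U)$ with weak gradient $\nabla\varphi\in L^2(\mu_U)^d$, and $L^2_0(\mu_U)$ the set of $\varphi\in L^2(\mu_U)$ with $\int\varphi\,\mathrm d\mu_U=0$. Let $\mathfrak U_0$ be the set of functions $U\colon\mathbb D^d\to\mathbb R$ such that: $U$ is smooth; $\mathrm e^{-V-U}$ is Lebesgue integrable; there is $R>0$ with $\|\varphi\|_{L^2(\mu_U)}^2\le R^{-1}\|\nabla\varphi\|_{L^2(\mu_U)}^2$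 for all $\varphi\in H^1(\mu_U)\cap L^2_0(\mu_U)$; $(f-I)\mathrm e^U\in L^2(\mu_U)$; and for every $x_0\in\mathbb D^d$ the equation $\mathrm dX_t=-\nabla(V+U)(X_t)\,\mathrm dt+\sqrt2\,\mathrm dW_t$, $X_0=x_0$, has a unique strong solution. Denote by $\phi_U\in H^1(\mu_U)\cap L^2_0(\mu_U)$ the distributional solution to the Poisson equation $$-\mathcal L_U\phi_U=(f-I)\mathrm e^U,\qquad \mathcal L_U=\mathrm e^{V+U}\nabla\cdot\bigl(\mathrm e^{-V-U}\nabla\,\cdot\,\bigr),$$ and define the asymptotic variance $\sigma^2_f[U]=\dfrac{2Z[U]^2}{Z^2}\displaystyle\int_{\mathbb D^d}|\nabla\phi_U|^2\,\mathrm d\mu_U$. Theorem. Let $U\in\mathfrak U_0$ and let $\delta U\in C^\infty_{\mathrm c}(\mathbb D^d)$. For every $\varepsilon\in\mathbb R$ the solution $\phi_{U+\varepsilon\delta U}\in H^1(\mu_{U+\varepsilon\delta U})\cap L^2_0(\mu_{U+\varepsilon\delta U})$ exists and is unique up to almost everywhere equality (so that $\sigma^2_f[U+\varepsilon\delta U]$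 is well defined), the directional derivative $$\mathrm d\sigma^2_f[U]\cdot\delta U:=\lim_{\varepsilon\to0}\frac1\varepsilon\bigl(\sigma^2_f[U+\varepsilon\delta U]-\sigma^2_f[U]\bigr)$$ exists, and $$\frac12\,\mathrm d\sigma^2_f[U]\cdot\delta U=\frac{Z[U]^2}{Z^2}\int_{\mathbb D^d}\delta U\Bigl(|\nabla\phi_U|^2-\int_{\mathbb D^d}|\nabla\phi_U|^2\,\mathrm d\mu_U\Bigr)\,\mathrm d\mu_U .$$ -/

import Mathlib

open MeasureTheory ProbabilityTheory Filter Topology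
open scoped ContDiff NNReal

noncomputable section

namespace AsymVar

/-- The Euclidean space `ℝ^d`. -/
abbrev Sp (d : ℕ) : Type := EuclideanSpace ℝ (Fin d)

/-- The two possibilities for the one-dimensional domain `𝔻`: the real line `ℝ`, or the torus
`𝕋 = ℝ / 2πℤ`. -/
inductive Dom where
  | line
  | torus

/-- `IsOn D g`: the map `g` on `ℝ^d` is (the lift of) a map on `𝔻^d`.  Maps on `𝕋^d` are
identified with the maps on `ℝ^d` that are `2π`-periodic in each coordinate. -/
def IsOn {d : ℕ} {α : Type} (D : Dom) (g : Sp d → α) : Prop :=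
  match D with
  | .line => True
  | .torus => ∀ (i : Fin d) (x : Sp d), g (x + EuclideanSpace.single i (2 * Real.pi)) = g x

/-- The Lebesgue measure of `𝔻^d`; for the torus it is carried by the fundamental cell
`(-π, π]^d`. -/
def vol (D : Dom) (d : ℕ) : Measure (Sp d) :=
  match D with
  | .line => volume
  | .torus => volume.restrict {x | ∀ i, x i ∈ Set.Ioc (-Real.pi) Real.pi}

/-- `g` is a smooth real function on `𝔻^d`. -/
structure IsSmooth {d : ℕ} (D : Dom) (g : Sp d → ℝ) : Prop where
  isOn : IsOn D g
  contDiff : ContDiff ℝ ∞ g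

/-- `ξ ∈ C_c^∞(𝔻^d)`: smooth with compact support in `𝔻^d` (no condition on the support
for the torus, which is compact). -/
structure IsTest {d : ℕ} (D : Dom) (ξ : Sp d → ℝ) : Prop where
  smooth : IsSmooth D ξ
  compact : D = Dom.line → HasCompactSupport ξ

variable {d : ℕ}

/-- The normalization constant `∫_{𝔻^d} e^{-W}`. -/
def Zc (D : Dom) (W : Sp d → ℝ) : ℝ := ∫ x, Real.exp (-W x) ∂(vol D d)

/-- The probability measure on `𝔻^d` with Lebesgue density `e^{-W} / ∫ e^{-W}`.
Thus `μ = gibbs D V` and `μ_U = gibbs D (V + U)`. -/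
def gibbs (D : Dom) (W : Sp d → ℝ) : Measure (Sp d) :=
  (vol D d).withDensity fun x => ENNReal.ofReal (Real.exp (-W x) / Zc D W)

/-- The target mean `I = ∫ f dμ`. -/
def mean (D : Dom) (V f : Sp d → ℝ) : ℝ := ∫ x, f x ∂(gibbs D V)

/-- `G` is the weak gradient on `𝔻^d` of the locally integrable function `φ`. -/
structure IsWeakGrad (D : Dom) (φ : Sp d → ℝ) (G : Sp d → Sp d) : Prop where
  isOn_fun : IsOn D φ
  isOn_grad : IsOn D G
  locInt_fun : LocallyIntegrable φ (vol D d)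
  locInt_grad : LocallyIntegrable G (vol D d)
  parts : ∀ ξ : Sp d → ℝ, IsTest D ξ → ∀ i : Fin d,
    ∫ x, φ x * (gradient ξ x) i ∂(vol D d) = -∫ x, G x i * ξ x ∂(vol D d)

/-- `φ ∈ H¹(m)`, with weak gradient `G`. -/
structure MemH1 (D : Dom) (m : Measure (Sp d)) (φ : Sp d → ℝ) (G : Sp d → Sp d) : Prop where
  weakGrad : IsWeakGrad D φ G
  memLp_fun : MemLp φ 2 m
  memLp_grad : MemLp G 2 m

/-- The Poincaré inequality on `H¹(m) ∩ L²₀(m)`, with some constant `R > 0`. -/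
def Poincare (D : Dom) (m : Measure (Sp d)) : Prop :=
  ∃ R : ℝ, 0 < R ∧ ∀ (φ : Sp d → ℝ) (G : Sp d → Sp d), MemH1 D m φ G → ∫ x, φ x ∂m = 0 →
    ∫ x, φ x ^ 2 ∂m ≤ 1 / R * ∫ x, ‖G x‖ ^ 2 ∂m

/-- `W` is a standard `d`-dimensional Brownian motion: its coordinates are independent standard
real Brownian motions. -/
structure IsBM {Ω : Type} [MeasurableSpace Ω] (P : Measure Ω) (W : ℝ≥0 → Ω → Sp d) : Prop where
  coord : ∀ i : Fin d, IsBrownianReal (fun t w => W t w i) P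
  indep : iIndepFun (fun (i : Fin d) (w : Ω) (t : ℝ≥0) => W t w i) P

/-- `X` is a strong solution, driven by the Brownian motion `W` and started from `x₀`, to
`dX_t = b(X_t) dt + √2 dW_t`: it is adapted to the (completed) filtration of `W`, it has continuous
paths and it satisfies the integrated equation at all times, almost surely. -/
structure IsStrongSol {Ω : Type} [MeasurableSpace Ω] (P : Measure Ω) (W : ℝ≥0 → Ω → Sp d)
    (b : Sp d → Sp d) (x₀ : Sp d) (X : ℝ≥0 → Ω → Sp d) : Prop where
  adapted : ∀ t : ℝ≥0, AEStronglyMeasurable[⨆ s : Set.Iic t,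
    MeasurableSpace.comap (W s) inferInstance] (X t) P
  cont : ∀ᵐ w ∂P, Continuous fun t => X t w
  eq : ∀ᵐ w ∂P, ∀ t : ℝ≥0,
    X t w = x₀ + (∫ s in (0 : ℝ)..t, b (X s.toNNReal w)) + √2 • W t w

/-- From every starting point, the equation `dX_t = b(X_t) dt + √2 dW_t` has a unique strong
solution (up to indistinguishability), whatever the driving Brownian motion.  For a periodic
drift `b`, this is the equation on the torus, lifted to `ℝ^d`. -/
def StrongWellPosed (b : Sp d → Sp d) : Prop :=
  ∀ (Ω : Type) [MeasurableSpace Ω] (P : Measure Ω) [IsProbabilityMeasure P]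
    (W : ℝ≥0 → Ω → Sp d), IsBM P W → ∀ x₀ : Sp d,
      (∃ X, IsStrongSol P W b x₀ X) ∧
      ∀ X X', IsStrongSol P W b x₀ X → IsStrongSol P W b x₀ X' →
        ∀ᵐ w ∂P, ∀ t, X t w = X' t w

/-- The standing assumptions on the potential `V` and the observable `f`. -/
structure Standing (D : Dom) (V f : Sp d → ℝ) : Prop where
  smooth_pot : IsSmooth D V
  integrable_exp : Integrable (fun x => Real.exp (-V x)) (vol D d)
  smooth_obs : IsSmooth D f
  integrable_obs : Integrable f (gibbs D V)
  not_const : ¬ ∃ c : ℝ, ∀ᵐ x ∂(gibbs D V), f x = c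

/-- `U ∈ 𝔘₀(V, f)`: the class of admissible biasing potentials. -/
structure Admissible (D : Dom) (V f U : Sp d → ℝ) : Prop where
  smooth : IsSmooth D U
  integrable_exp : Integrable (fun x => Real.exp (-(V + U) x)) (vol D d)
  poincare : Poincare D (gibbs D (V + U))
  memLp : MemLp (fun x => (f x - mean D V f) * Real.exp (U x)) 2 (gibbs D (V + U))
  wellPosed : StrongWellPosed fun x => -gradient V x - gradient U x

/-- `φ`, with weak gradient `G`, is a distributional solution in `H¹(μ_U) ∩ L²₀(μ_U)` to the
Poisson equation `-𝓛_U φ = (f - I) e^U`, where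
`𝓛_U = e^{V+U} ∇ · (e^{-V-U} ∇ ·) = Δ - ∇(V + U) · ∇`.
The equation is multiplied by the density of `μ_U` and tested against `C_c^∞(𝔻^d)`. -/
structure IsPoissonSol (D : Dom) (V f U : Sp d → ℝ) (φ : Sp d → ℝ) (G : Sp d → Sp d) : Prop where
  memH1 : MemH1 D (gibbs D (V + U)) φ G
  mean_zero : ∫ x, φ x ∂(gibbs D (V + U)) = 0
  eq : ∀ ξ : Sp d → ℝ, IsTest D ξ →
    ∫ x, inner ℝ (G x) (gradient ξ x) ∂(gibbs D (V + U)) =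
      ∫ x, (f x - mean D V f) * Real.exp (U x) * ξ x ∂(gibbs D (V + U))

/-- Existence and (almost everywhere) uniqueness of the solution `φ_U` to the Poisson equation,
and of its weak gradient. -/
def PoissonWellPosed (D : Dom) (V f U : Sp d → ℝ) : Prop :=
  ∃ φ G, IsPoissonSol D V f U φ G ∧
    ∀ φ' G', IsPoissonSol D V f U φ' G' → φ' =ᵐ[vol D d] φ ∧ G' =ᵐ[vol D d] G

open Classical in
/-- The gradient `∇φ_U` of the solution to the Poisson equation (`0` if there is no solution). -/
def poissonGrad (D : Dom) (V f U : Sp d → ℝ) : Sp d → Sp d :=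
  if h : ∃ G φ, IsPoissonSol D V f U φ G then h.choose else 0

/-- The asymptotic variance `σ²_f[U] = (2 Z[U]² / Z²) ∫ |∇φ_U|² dμ_U`. -/
def asymVar (D : Dom) (V f U : Sp d → ℝ) : ℝ :=
  2 * Zc D (V + U) ^ 2 / Zc D V ^ 2 * ∫ x, ‖poissonGrad D V f U x‖ ^ 2 ∂(gibbs D (V + U))

/-- The directional derivative `dE[U] · δU = lim_{ε → 0} (E[U + ε δU] - E[U]) / ε` exists and is
equal to `L`. -/
def HasDirDeriv (E : (Sp d → ℝ) → ℝ) (U δU : Sp d → ℝ) (L : ℝ) : Prop :=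
  Tendsto (fun ε : ℝ => 1 / ε * (E (U + ε • δU) - E U)) (𝓝[≠] 0) (𝓝 L)

end AsymVar

end

/-!
The Poincaré inequality makes `∫ ∇φ · ∇ψ dμ_U` coercive on mean-zero functions, so the
Lax–Milgram theorem solves the Poisson equation. Cutoff and mollification make the test functions
dense, so the weak equation can be tested against every Sobolev function; testing the difference of
two solutions against itself yields uniqueness. A bounded perturbation `w` of `U` changes `μ_U` only
by a density bounded above and below, so it keeps the Poincaré inequality and `H¹`.

The weight `e^U` in the source makes the unnormalized right-hand side independent of `U`: only the
density `e^{-V-U}` of the Dirichlet form is perturbed. Write `G = ∇φ_U` and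
`E(ε) = ∫ e^{-ε δU} |∇φ_{U+ε δU}|² dμ_U`. Dirichlet's principle, tested with `φ_U`, and Thomson's
principle, tested with the flux `G`, give
`2 ∫ |G|² dμ_U - ∫ e^{-ε δU} |G|² dμ_U ≤ E(ε) ≤ ∫ e^{ε δU} |G|² dμ_U`.
The two bounds agree to first order at `ε = 0`, so `E` is differentiable there with derivative
`∫ δU |G|² dμ_U`, without any differentiation of the solution; the remaining factor of the
asymptotic variance is the partition function, whose derivative is explicit.
-/

open scoped Convolution

noncomputable section

namespace AsymVar

variable {d : ℕ}

/-! ### Mollification -/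

/-- `h ∈ L²_loc(μ)`. -/
def LocallyL2 {E F : Type*} [TopologicalSpace E] [MeasurableSpace E] [NormedAddCommGroup F]
    (h : E → F) (μ : Measure E) : Prop :=
  ∀ K : Set E, IsCompact K → MemLp h 2 (μ.restrict K)

section LocallyL2

variable {E F : Type*} [MetricSpace E] [MeasurableSpace E] {μ : Measure E} [NormedAddCommGroup F]

lemma LocallyL2.locallyIntegrable [ProperSpace E] [IsFiniteMeasureOnCompacts μ] {h : E → F}
    (hh : LocallyL2 h μ) : LocallyIntegrable h μ :=
  locallyIntegrable_iff.2 fun K hK =>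
    have : Fact (μ K < ⊤) := ⟨hK.measure_lt_top⟩
    (hh K hK).integrable (by norm_num)

lemma LocallyL2.memLp_restrict [ProperSpace E] {h : E → F} (hh : LocallyL2 h μ) {T : Set E}
    (hT : Bornology.IsBounded T) : MemLp h 2 (μ.restrict T) :=
  (hh _ hT.isCompact_closure).mono_measure (Measure.restrict_mono_set μ subset_closure)

variable [BorelSpace E]

variable [NormedSpace ℝ F]

lemma LocallyL2.continuous_smul {h : E → F} {k : E → ℝ} (hh : LocallyL2 h μ)
    (hk : Continuous k) : LocallyL2 (fun x => k x • h x) μ := by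
  intro K hK
  obtain ⟨C, hC⟩ := hK.exists_bound_of_continuousOn hk.continuousOn
  refine (hh K hK).of_le_mul (c := C) (hk.aestronglyMeasurable.smul (hh K hK).1) ?_
  filter_upwards [ae_restrict_mem hK.measurableSet] with x hx
  rw [norm_smul]
  exact mul_le_mul_of_nonneg_right (hC x hx) (norm_nonneg _)

lemma LocallyL2.smul_continuous [ProperSpace E] {h : E → ℝ} {k : E → F} (hh : LocallyL2 h μ)
    (hk : Continuous k) : LocallyL2 (fun x => h x • k x) μ := by
  intro K hK
  obtain ⟨C, hC⟩ := hK.exists_bound_of_continuousOn hk.continuousOn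
  refine (hh K hK).of_le_mul (c := C) ((hh K hK).1.smul hk.aestronglyMeasurable) ?_
  filter_upwards [ae_restrict_mem hK.measurableSet] with x hx
  rw [norm_smul, mul_comm]
  exact mul_le_mul_of_nonneg_right (hC x hx) (norm_nonneg _)

end LocallyL2

section Mollification

variable {E : Type*} [NormedAddCommGroup E] [NormedSpace ℝ E] [FiniteDimensional ℝ E]
  [MeasurableSpace E] [BorelSpace E] {μ : Measure E} [μ.IsAddHaarMeasure]
  {F : Type*} [NormedAddCommGroup F] [InnerProductSpace ℝ F]

lemma continuous_integral_inner_translate {f g : E → F} (hf : MemLp f 2 μ) (hg : MemLp g 2 μ) :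
    Continuous fun s => ∫ x, inner ℝ (f x) (g (s + x)) ∂μ := by
  have : Fact ((2 : ENNReal) ≠ ⊤) := ⟨by simp⟩
  have h_inner : (fun s => ∫ x, inner ℝ (f x) (g (s + x)) ∂μ) =
      fun s => inner ℝ (hf.toLp f) (DomAddAct.mk s +ᵥ hg.toLp g) := by
    ext s
    rw [L2.inner_def, DomAddAct.mk_vadd_toLp]
    have hg_coe := (hg.comp_measurePreserving (measurePreserving_vadd s μ)).coeFn_toLp
    refine integral_congr_ae ?_
    filter_upwards [hf.coeFn_toLp, hg_coe] with x hfx hgx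
    rw [hfx]
    exact congrArg (inner ℝ (f x)) hgx.symm
  rw [h_inner]
  exact continuous_const.inner (DomAddAct.mkHomeomorph.continuous.vadd continuous_const)

lemma integrable_inner_convolution_integrand {f g : E → F} (hf : MemLp f 2 μ) (hg : MemLp g 2 μ)
    {e : E → ℝ} (he : Integrable e μ) :
    Integrable (Function.uncurry fun x t => inner ℝ (f x) (e t • g (x - t))) (μ.prod μ) := by
  have hf_sq : Integrable (fun p : E × E => ‖f p.1‖ ^ 2 * ‖e p.2‖) (μ.prod μ) :=
    (hf.integrable_norm_pow two_ne_zero).mul_prod he.norm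
  have hg_sq := he.norm.convolution_integrand (ContinuousLinearMap.lsmul ℝ ℝ)
    (hg.integrable_norm_pow two_ne_zero)
  have h_meas := he.aestronglyMeasurable.convolution_integrand (μ := μ)
    (ContinuousLinearMap.lsmul ℝ ℝ) hg.aestronglyMeasurable
  refine (hf_sq.add hg_sq).mono' (hf.aestronglyMeasurable.comp_fst.inner h_meas)
    (Eventually.of_forall fun p => ?_)
  have h_cs := norm_inner_le_norm (𝕜 := ℝ) (f p.1) (e p.2 • g (p.1 - p.2))
  have h_amgm := mul_nonneg (norm_nonneg (e p.2)) (sq_nonneg (‖f p.1‖ - ‖g (p.1 - p.2)‖))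
  have h_nonneg := mul_nonneg (norm_nonneg (e p.2))
    (add_nonneg (sq_nonneg ‖f p.1‖) (sq_nonneg ‖g (p.1 - p.2)‖))
  rw [norm_smul] at h_cs
  simp only [Function.uncurry, Pi.add_apply, ContinuousLinearMap.lsmul_apply, smul_eq_mul]
  linarith

lemma integral_inner_convolution {f g : E → F} (hf : MemLp f 2 μ) (hg : MemLp g 2 μ)
    {e : E → ℝ} (he : Continuous e) (hec : HasCompactSupport e) [CompleteSpace F] :
    ∫ x, inner ℝ (f x) ((e ⋆[.lsmul ℝ ℝ, μ] g) x) ∂μ =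
      (e ⋆[.lsmul ℝ ℝ, μ] fun s => ∫ x, inner ℝ (f x) (g (s + x)) ∂μ) 0 := by
  have h_exists := hec.convolutionExists_left (ContinuousLinearMap.lsmul ℝ ℝ) he
    (hg.locallyIntegrable (by norm_num))
  have h_swap := integral_integral_swap (integrable_inner_convolution_integrand hf hg
    (he.integrable_of_hasCompactSupport hec))
  calc ∫ x, inner ℝ (f x) ((e ⋆[.lsmul ℝ ℝ, μ] g) x) ∂μ
      = ∫ x, ∫ t, inner ℝ (f x) (e t • g (x - t)) ∂μ ∂μ :=
        integral_congr_ae (Eventually.of_forall fun x => (integral_inner (h_exists x) (f x)).symm)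
    _ = ∫ t, ∫ x, inner ℝ (f x) (e t • g (x - t)) ∂μ ∂μ := h_swap
    _ = _ := by
        simp only [convolution_lsmul, inner_smul_right, integral_const_mul, zero_sub,
          neg_add_eq_sub, smul_eq_mul]

lemma tendsto_integral_inner_convolution_normed [CompleteSpace F] {f g : E → F}
    (hf : MemLp f 2 μ) (hg : MemLp g 2 μ) {η : ℕ → ContDiffBump (0 : E)}
    (hη : Tendsto (fun n => (η n).rOut) atTop (𝓝 0)) :
    Tendsto (fun n => ∫ x, inner ℝ (f x) (((η n).normed μ ⋆[.lsmul ℝ ℝ, μ] g) x) ∂μ) atTop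
      (𝓝 (∫ x, inner ℝ (f x) (g x) ∂μ)) := by
  simp only [integral_inner_convolution hf hg (η _).continuous_normed
    (η _).hasCompactSupport_normed]
  simpa only [zero_add] using ContDiffBump.convolution_tendsto_right_of_continuous hη
    (continuous_integral_inner_translate hf hg) 0

lemma convolution_normed_congr {η : ContDiffBump (0 : E)} {g h : E → F} {x : E} {r : ℝ}
    (hη : η.rOut ≤ r) (hgh : ∀ y, dist y x ≤ r → g y = h y) :
    (η.normed μ ⋆[.lsmul ℝ ℝ, μ] g) x = (η.normed μ ⋆[.lsmul ℝ ℝ, μ] h) x := by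
  refine integral_congr_ae (Eventually.of_forall fun t => ?_)
  by_cases ht : t ∈ Metric.ball 0 η.rOut
  · have h_dist : dist (x - t) x ≤ r := by
      rw [dist_eq_norm, sub_sub_cancel_left, norm_neg]
      exact (mem_ball_zero_iff.1 ht).le.trans hη
    exact congrArg (η.normed μ t • ·) (hgh _ h_dist)
  · rw [← η.support_normed_eq (μ := μ), Function.notMem_support] at ht
    simp only [ht, map_zero, zero_apply]

lemma tendsto_setIntegral_inner_convolution_normed [CompleteSpace F] {f g : E → F} {T : Set E}
    (hT : MeasurableSet T) (hTb : Bornology.IsBounded T) (hf : MemLp f 2 (μ.restrict T))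
    (hg : LocallyL2 g μ) {η : ℕ → ContDiffBump (0 : E)}
    (hη : Tendsto (fun n => (η n).rOut) atTop (𝓝 0)) :
    Tendsto (fun n => ∫ x in T, inner ℝ (f x) (((η n).normed μ ⋆[.lsmul ℝ ℝ, μ] g) x) ∂μ) atTop
      (𝓝 (∫ x in T, inner ℝ (f x) (g x) ∂μ)) := by
  classical
  let K := Metric.cthickening 1 T
  have hK : MeasurableSet K := Metric.isClosed_cthickening.measurableSet
  have h_indicator (h : E → F) : ∫ x in T, inner ℝ (f x) (h x) ∂μ =
      ∫ x, inner ℝ (T.indicator f x) (h x) ∂μ := by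
    rw [← integral_indicator hT]
    congr 1 with x
    by_cases hx : x ∈ T <;> simp [hx]
  have h_local {n : ℕ} (hn : (η n).rOut ≤ 1) :
      ∫ x in T, inner ℝ (f x) (((η n).normed μ ⋆[.lsmul ℝ ℝ, μ] K.indicator g) x) ∂μ =
        ∫ x in T, inner ℝ (f x) (((η n).normed μ ⋆[.lsmul ℝ ℝ, μ] g) x) ∂μ :=
    setIntegral_congr_fun hT fun x hx => congrArg (inner ℝ (f x)) <|
      convolution_normed_congr hn fun y hy =>
        Set.indicator_of_mem (Metric.mem_cthickening_of_dist_le y x 1 T hx hy) g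
  have hf' : MemLp (T.indicator f) 2 μ := (memLp_indicator_iff_restrict hT).2 hf
  have hg' : MemLp (K.indicator g) 2 μ :=
    (memLp_indicator_iff_restrict hK).2 (hg.memLp_restrict hTb.cthickening)
  have h_lim := tendsto_integral_inner_convolution_normed hf' hg' hη
  have h_eq : ∫ x in T, inner ℝ (f x) (K.indicator g x) ∂μ = ∫ x in T, inner ℝ (f x) (g x) ∂μ :=
    setIntegral_congr_fun hT fun x hx => congrArg (inner ℝ (f x))
      (Set.indicator_of_mem (Metric.self_subset_cthickening T hx) g)
  simp only [← h_indicator, h_eq] at h_lim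
  refine h_lim.congr' ?_
  filter_upwards [hη.eventually_le_const one_pos] with n hn using h_local hn

lemma tendsto_integral_inner_convolution_normed_of_hasCompactSupport [CompleteSpace F]
    {f g : E → F} (hf : LocallyL2 f μ) (hg : LocallyL2 g μ) (hgc : HasCompactSupport g)
    {η : ℕ → ContDiffBump (0 : E)} (hη : Tendsto (fun n => (η n).rOut) atTop (𝓝 0)) :
    Tendsto (fun n => ∫ x, inner ℝ (f x) (((η n).normed μ ⋆[.lsmul ℝ ℝ, μ] g) x) ∂μ) atTop
      (𝓝 (∫ x, inner ℝ (f x) (g x) ∂μ)) := by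
  let T := Metric.cthickening 1 (tsupport g)
  have h_lim := tendsto_setIntegral_inner_convolution_normed
    Metric.isClosed_cthickening.measurableSet hgc.isBounded.cthickening
    (hf.memLp_restrict hgc.isBounded.cthickening : MemLp f 2 (μ.restrict T)) hg hη
  rw [setIntegral_eq_integral_of_forall_compl_eq_zero fun x hx => by
    rw [image_eq_zero_of_notMem_tsupport fun h => hx (Metric.self_subset_cthickening _ h),
      inner_zero_right]] at h_lim
  refine h_lim.congr' ?_
  filter_upwards [hη.eventually_le_const one_pos] with n hn
  refine setIntegral_eq_integral_of_forall_compl_eq_zero fun x hx => ?_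
  have h_zero : ∀ y, dist y x ≤ 1 → g y = 0 := fun y hy =>
    image_eq_zero_of_notMem_tsupport fun h =>
      hx (Metric.mem_cthickening_of_dist_le x y 1 _ h (dist_comm x y ▸ hy))
  rw [convolution_normed_congr (h := 0) hn h_zero]
  simp only [convolution_zero, Pi.zero_apply, inner_zero_right]

end Mollification

/-! ### Functions on the domain -/

section Functions

variable {D : Dom} {α β γ : Type}

lemma IsOn.comp {g : Sp d → α} (hg : IsOn D g) (k : α → β) : IsOn D fun x => k (g x) := by
  cases D with
  | line => trivial
  | torus => exact fun i x => congrArg k (hg i x)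

lemma IsOn.comp₂ {g : Sp d → α} {h : Sp d → β} (hg : IsOn D g) (hh : IsOn D h) (k : α → β → γ) :
    IsOn D fun x => k (g x) (h x) := by
  cases D with
  | line => trivial
  | torus => exact fun i x => congrArg₂ k (hg i x) (hh i x)

lemma IsOn.const (a : α) : IsOn (d := d) D fun _ => a := by
  cases D with
  | line => trivial
  | torus => exact fun _ _ => rfl

lemma IsOn.fderiv {ξ : Sp d → ℝ} (h : IsOn D ξ) : IsOn D (fderiv ℝ ξ) := by
  cases D with
  | line => trivial
  | torus =>
    intro i x
    rw [← fderiv_comp_add_right, show (fun y => ξ (y + _)) = ξ from funext (h i)]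

lemma IsOn.gradient {ξ : Sp d → ℝ} (h : IsOn D ξ) : IsOn D (gradient ξ) :=
  h.fderiv.comp (InnerProductSpace.toDual ℝ (Sp d)).symm

lemma IsOn.convolution {F : Type} [NormedAddCommGroup F] [NormedSpace ℝ F] {u : Sp d → F}
    (hu : IsOn D u) (e : Sp d → ℝ) : IsOn D (e ⋆[.lsmul ℝ ℝ, volume] u) := by
  cases D with
  | line => trivial
  | torus => exact fun i x => by simp only [convolution_def, add_sub_right_comm, hu i]

/-- `C_c(𝔻^d)`: the continuous functions with compact support in `𝔻^d`, which is no condition on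
the support for the torus. -/
structure IsCc (D : Dom) (q : Sp d → ℝ) : Prop where
  isOn : IsOn D q
  continuous : Continuous q
  compact : D = Dom.line → HasCompactSupport q

lemma IsCc.mul_right {q k : Sp d → ℝ} (hq : IsCc D q) (hk : Continuous k) (hkD : IsOn D k) :
    IsCc D fun x => q x * k x :=
  ⟨hq.isOn.comp₂ hkD (· * ·), hq.continuous.mul hk, fun h => (hq.compact h).mul_right⟩

lemma gradient_apply (ξ : Sp d → ℝ) (x : Sp d) (i : Fin d) :
    gradient ξ x i = fderiv ℝ ξ x (EuclideanSpace.single i 1) := by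
  rw [← inner_gradient_left, real_inner_comm, EuclideanSpace.inner_single_left]
  simp only [map_one, one_mul]

lemma continuous_gradient {ξ : Sp d → ℝ} (hξ : ContDiff ℝ ∞ ξ) : Continuous (gradient ξ) :=
  (InnerProductSpace.toDual ℝ (Sp d)).symm.continuous.comp (hξ.continuous_fderiv (by simp))

lemma continuous_gradient_apply {ξ : Sp d → ℝ} (hξ : ContDiff ℝ ∞ ξ) (i : Fin d) :
    Continuous fun x => gradient ξ x i :=
  (PiLp.continuous_apply 2 _ i).comp (continuous_gradient hξ)

lemma gradient_mul {ξ χ : Sp d → ℝ} (hχ : ContDiff ℝ ∞ χ) (hξ : ContDiff ℝ ∞ ξ) (x : Sp d) :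
    gradient (fun y => χ y * ξ y) x = χ x • gradient ξ x + ξ x • gradient χ x := by
  simp only [gradient, fderiv_fun_mul (hχ.differentiable (by simp) x)
    (hξ.differentiable (by simp) x), map_add, map_smulₛₗ, conj_trivial]

lemma IsTest.isCc {ξ : Sp d → ℝ} (hξ : IsTest D ξ) : IsCc D ξ :=
  ⟨hξ.smooth.isOn, hξ.smooth.contDiff.continuous, hξ.compact⟩

lemma IsTest.fderiv_apply {ξ : Sp d → ℝ} (hξ : IsTest D ξ) (v : Sp d) :
    IsTest D fun x => fderiv ℝ ξ x v where
  smooth := ⟨hξ.smooth.isOn.fderiv.comp fun L : Sp d →L[ℝ] ℝ => L v,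
    (hξ.smooth.contDiff.fderiv_right (m := ∞) (by simp)).clm_apply contDiff_const⟩
  compact h := (hξ.compact h).fderiv_apply ℝ v

lemma IsTest.gradient_apply {ξ : Sp d → ℝ} (hξ : IsTest D ξ) (i : Fin d) :
    IsTest D fun x => gradient ξ x i := by
  simpa only [AsymVar.gradient_apply] using hξ.fderiv_apply (EuclideanSpace.single i 1)

lemma IsTest.mul_left {ξ χ : Sp d → ℝ} (hξ : IsTest D ξ) (hχ : IsSmooth D χ) :
    IsTest D fun x => χ x * ξ x :=
  ⟨⟨hχ.isOn.comp₂ hξ.smooth.isOn (· * ·), hχ.contDiff.mul hξ.smooth.contDiff⟩,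
    fun h => (hξ.compact h).mul_left⟩

end Functions

/-! ### The torus -/

/-- The basis `2π e₁, …, 2π e_d` of the lattice of periods of the torus. -/
def periodBasis (d : ℕ) : Module.Basis (Fin d) ℝ (Sp d) :=
  (EuclideanSpace.basisFun (Fin d) ℝ).toBasis.isUnitSMul (w := fun _ => 2 * Real.pi)
    fun _ => Real.two_pi_pos.ne'.isUnit

lemma periodBasis_apply (i : Fin d) :
    periodBasis d i = EuclideanSpace.single i (2 * Real.pi) := by
  ext j
  simp [periodBasis, Module.Basis.isUnitSMul_apply]

/-- The lattice `2πℤ^d`, so that `𝕋^d = ℝ^d / periods d`. -/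
abbrev periods (d : ℕ) : Submodule ℤ (Sp d) := Submodule.span ℤ (Set.range (periodBasis d))

lemma mem_periods {l : Sp d} : l ∈ periods d ↔ ∃ k : Fin d → ℤ, ∀ i, l i = k i * (2 * Real.pi) := by
  simp only [Submodule.mem_span_range_iff_exists_fun, periodBasis_apply]
  refine exists_congr fun k => ⟨?_, fun hk => ?_⟩
  · rintro rfl i
    simp [Finset.sum_apply, Pi.single_apply]
  · ext i
    simp [hk, Finset.sum_apply, Pi.single_apply]

lemma isOn_torus_iff {α : Type} {g : Sp d → α} :
    IsOn Dom.torus g ↔ ∀ l ∈ periods d, ∀ x, g (l + x) = g x := by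
  refine ⟨fun hg l hl => ?_, fun hg i x => ?_⟩
  · induction hl using Submodule.span_induction with
    | mem l hl =>
      obtain ⟨i, rfl⟩ := hl
      exact fun x => by rw [add_comm, periodBasis_apply, hg i x]
    | zero => exact fun x => by rw [zero_add]
    | add l m _ _ hl hm => exact fun x => by rw [add_assoc, hl, hm]
    | smul n l _ hl =>
      have h_neg : ∀ x, g (-l + x) = g x := fun x => by rw [← hl, add_neg_cancel_left]
      induction n with
      | zero => exact fun x => by rw [zero_smul, zero_add]
      | succ n ih => exact fun x => by rw [add_smul, one_smul, add_assoc, ih, hl]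
      | pred n ih => exact fun x => by rw [sub_smul, one_smul, sub_eq_add_neg, add_assoc, ih, h_neg]
  · rw [add_comm]
    exact hg _ (periodBasis_apply i ▸ Submodule.subset_span ⟨i, rfl⟩) x

/-- The fundamental cell `(-π, π]^d` of the torus. -/
def cell (d : ℕ) : Set (Sp d) := {x | ∀ i, x i ∈ Set.Ioc (-Real.pi) Real.pi}

lemma measurableSet_cell : MeasurableSet (cell d) := by
  simp only [cell, Set.ofPred_forall]
  exact MeasurableSet.iInter fun i =>
    (EuclideanSpace.proj (𝕜 := ℝ) i).continuous.measurable measurableSet_Ioc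

lemma existsUnique_add_mem_cell (x : Sp d) : ∃! l : periods d, (l : Sp d) + x ∈ cell d := by
  have h i := existsUnique_add_zsmul_mem_Ioc Real.two_pi_pos (x i) (-Real.pi)
  have h_end : -Real.pi + 2 * Real.pi = Real.pi := by ring
  simp only [h_end, zsmul_eq_mul] at h
  choose k hk hk_unique using h
  refine ⟨⟨WithLp.toLp 2 fun i => k i * (2 * Real.pi), mem_periods.2 ⟨k, fun _ => rfl⟩⟩,
    fun i => ?_, ?_⟩
  · simpa [add_comm] using hk i
  · rintro ⟨l, hl⟩ hlx
    obtain ⟨m, hm⟩ := mem_periods.1 hl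
    ext i
    have hmk : m i = k i := hk_unique i (m i) (by simpa [hm, add_comm] using hlx i)
    simp [hm, hmk]

instance : VAddInvariantMeasure (periods d) (Sp d) volume :=
  inferInstanceAs (VAddInvariantMeasure (periods d).toAddSubgroup (Sp d) volume)

lemma isAddFundamentalDomain_cell : IsAddFundamentalDomain (periods d) (cell d) volume :=
  .mk' measurableSet_cell.nullMeasurableSet existsUnique_add_mem_cell

lemma isBounded_cell : Bornology.IsBounded (cell d) :=
  ((PiLp.antilipschitzWith_ofLp 2 fun _ : Fin d => ℝ).isBounded_preimage
    (Bornology.IsBounded.pi fun _ => Metric.isBounded_Ioc (-Real.pi) Real.pi)).subset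
    fun _ hx i _ => hx i

lemma cell_mem_nhds_zero : cell d ∈ 𝓝 0 := by
  simp only [cell, Set.ofPred_forall]
  exact Filter.iInter_mem.2 fun i => (EuclideanSpace.proj (𝕜 := ℝ) i).continuous.continuousAt
    (Ioc_mem_nhds (by simp [Real.pi_pos]) (by simp [Real.pi_pos]))

lemma vol_torus : vol Dom.torus d = volume.restrict (cell d) := rfl

instance : IsFiniteMeasure (vol Dom.torus d) :=
  ⟨by simpa [vol_torus] using isBounded_cell.measure_lt_top⟩

section Periodic

open scoped Pointwise

variable {F : Type} [NormedAddCommGroup F] {q : Sp d → F}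

lemma isAddFundamentalDomain_vadd_cell (v : Sp d) :
    IsAddFundamentalDomain (periods d) (v +ᵥ cell d) volume :=
  isAddFundamentalDomain_cell.vadd_of_comm v

lemma IsOn.locallyIntegrable (hq : IsOn Dom.torus q) (hi : Integrable q (vol Dom.torus d)) :
    LocallyIntegrable q volume := fun v => by
  have h_nhds : v +ᵥ cell d ∈ 𝓝 (v +ᵥ (0 : Sp d)) := vadd_mem_nhds_vadd_iff v |>.2
    cell_mem_nhds_zero
  rw [vadd_eq_add, add_zero] at h_nhds
  exact ⟨_, h_nhds, ((isAddFundamentalDomain_vadd_cell v).integrableOn_iff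
    isAddFundamentalDomain_cell fun l x => isOn_torus_iff.1 hq l l.2 x).2 hi⟩

lemma integrable_vol_torus (hq : LocallyIntegrable q (vol Dom.torus d)) :
    Integrable q (vol Dom.torus d) := by
  have h := hq.integrableOn_isCompact isBounded_cell.isCompact_closure
  rwa [vol_torus, IntegrableOn, Measure.restrict_restrict isClosed_closure.measurableSet,
    Set.inter_eq_right.2 subset_closure] at h

lemma IsOn.setIntegral_cell_comp_add [NormedSpace ℝ F] (hq : IsOn Dom.torus q) (v : Sp d) :
    ∫ x in cell d, q (v + x) = ∫ x in cell d, q x := by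
  calc ∫ x in cell d, q (v + x)
      = ∫ x in v +ᵥ cell d, q x :=
        ((measurePreserving_vadd v volume).setIntegral_image_emb
          (measurableEmbedding_const_vadd v) q (cell d)).symm
    _ = ∫ x in cell d, q x := (isAddFundamentalDomain_vadd_cell v).setIntegral_eq
        isAddFundamentalDomain_cell fun l x => isOn_torus_iff.1 hq l l.2 x

lemma IsOn.exists_bound_of_continuous (hq : IsOn Dom.torus q) (hc : Continuous q) :
    ∃ C, ∀ x, ‖q x‖ ≤ C := by
  obtain ⟨C, hC⟩ :=
    isBounded_cell.isCompact_closure.exists_bound_of_continuousOn hc.continuousOn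
  refine ⟨C, fun x => ?_⟩
  obtain ⟨l, hl, -⟩ := existsUnique_add_mem_cell x
  rw [← isOn_torus_iff.1 hq l l.2 x]
  exact hC _ (subset_closure hl)

end Periodic

section Periodization

open scoped Pointwise

/-- The sum of the translates of `h` by the lattice of periods, which maps `C_c^∞(ℝ^d)` to
`C^∞(𝕋^d)`. -/
def periodization (h : Sp d → ℝ) (x : Sp d) : ℝ := ∑ᶠ l : periods d, h (l + x)

lemma exists_finset_add_notMem {S T : Set (Sp d)} (hS : Bornology.IsBounded S)
    (hT : Bornology.IsBounded T) :
    ∃ s : Finset (periods d), ∀ x ∈ S, ∀ l ∉ s, (l : Sp d) + x ∉ T := by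
  have h_fin : {l : periods d | (l : Sp d) ∈ T - S}.Finite := by
    refine Set.Finite.of_finite_image
      ((ZSpan.setFinite_inter (periodBasis d) (hT.sub hS)).subset ?_) Subtype.val_injective.injOn
    rintro _ ⟨l, hl, rfl⟩
    exact ⟨hl, l.2⟩
  refine ⟨h_fin.toFinset, fun x hx l hl hlx => hl (h_fin.mem_toFinset.2 ?_)⟩
  exact ⟨l + x, hlx, x, hx, add_sub_cancel_right _ _⟩

lemma periodization_eq_sum {h : Sp d → ℝ} {s : Finset (periods d)} {x : Sp d}
    (hs : ∀ l ∉ s, (l : Sp d) + x ∉ tsupport h) : periodization h x = ∑ l ∈ s, h (l + x) :=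
  finsum_eq_sum_of_support_subset _ fun l hl => by_contra fun hls =>
    hs l hls (subset_tsupport h hl)

lemma isOn_periodization (h : Sp d → ℝ) : IsOn Dom.torus (periodization h) := by
  refine isOn_torus_iff.2 fun l hl x => ?_
  refine Eq.trans ?_ (finsum_comp_equiv (Equiv.addRight (⟨l, hl⟩ : periods d)))
  simp [periodization, add_assoc]

variable {ξ : Sp d → ℝ}

lemma IsTest.periodization_eventuallyEq (hξ : IsTest Dom.line ξ) (x : Sp d) :
    ∃ s : Finset (periods d), (∀ l ∉ s, (l : Sp d) + x ∉ tsupport ξ) ∧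
      periodization ξ =ᶠ[𝓝 x] fun y => ∑ l ∈ s, ξ (l + y) := by
  obtain ⟨s, hs⟩ := exists_finset_add_notMem (Metric.isBounded_ball (x := x) (r := 1))
    (hξ.compact rfl).isCompact.isBounded
  refine ⟨s, hs x (Metric.mem_ball_self one_pos), ?_⟩
  filter_upwards [Metric.ball_mem_nhds x one_pos] with y hy
  exact periodization_eq_sum (hs y hy)

lemma IsTest.periodization (hξ : IsTest Dom.line ξ) : IsTest Dom.torus (periodization ξ) := by
  refine ⟨⟨isOn_periodization ξ, contDiff_iff_contDiffAt.2 fun x => ?_⟩, nofun⟩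
  obtain ⟨s, -, hs⟩ := hξ.periodization_eventuallyEq x
  refine ContDiffAt.congr_of_eventuallyEq (ContDiff.contDiffAt ?_) hs
  exact ContDiff.sum fun l _ => hξ.smooth.contDiff.comp (contDiff_const.add contDiff_id)

lemma IsTest.fderiv_periodization (hξ : IsTest Dom.line ξ) (x v : Sp d) :
    fderiv ℝ (AsymVar.periodization ξ) x v =
      AsymVar.periodization (fun y => fderiv ℝ ξ y v) x := by
  obtain ⟨s, hsx, hs⟩ := hξ.periodization_eventuallyEq x
  have h_diff : Differentiable ℝ ξ := hξ.smooth.contDiff.differentiable (by simp)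
  rw [hs.fderiv_eq, periodization_eq_sum fun l hl hlx =>
    hsx l hl (tsupport_fderiv_apply_subset ℝ v hlx), fderiv_fun_sum]
  · simp only [fderiv_comp_add_left, sum_apply]
  · exact fun l _ => (h_diff _).comp x (differentiableAt_id.const_add _)

lemma setIntegral_cell_mul_periodization {φ h : Sp d → ℝ} (hφ : IsOn Dom.torus φ)
    (hi : Integrable φ (vol Dom.torus d)) (hh : Continuous h) (hc : HasCompactSupport h) :
    ∫ x in cell d, φ x * periodization h x = ∫ x, φ x * h x := by
  have h_loc := hφ.locallyIntegrable hi
  obtain ⟨s, hs⟩ := exists_finset_add_notMem isBounded_cell hc.isCompact.isBounded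
  have h_int (l : periods d) : Integrable (fun x => φ x * h (l + x)) volume :=
    h_loc.integrable_smul_right_of_hasCompactSupport (hh.comp (continuous_const.add continuous_id))
      (hc.comp_homeomorph (Homeomorph.addLeft (l : Sp d)))
  have h_zero : ∀ l ∉ s, ∫ x in cell d, φ x * h (l + x) = 0 := fun l hl =>
    setIntegral_eq_zero_of_forall_eq_zero fun x hx => by
      rw [image_eq_zero_of_notMem_tsupport (hs x hx l hl), mul_zero]
  calc ∫ x in cell d, φ x * periodization h x
      = ∫ x in cell d, ∑ l ∈ s, φ x * h (l + x) :=
        setIntegral_congr_fun measurableSet_cell fun x hx => by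
          rw [periodization_eq_sum (hs x hx), Finset.mul_sum]
    _ = ∑ l ∈ s, ∫ x in cell d, φ x * h (l + x) :=
        integral_finsetSum s fun l _ => (h_int l).integrableOn
    _ = ∑' l : periods d, ∫ x in cell d, φ x * h (l + x) := (tsum_eq_sum h_zero).symm
    _ = ∑' l : periods d, ∫ x in cell d, φ (l +ᵥ x) * h (l +ᵥ x) := by
        simp only [Submodule.vadd_def, vadd_eq_add, isOn_torus_iff.1 hφ _ (Subtype.prop _)]
    _ = ∫ x, φ x * h x := (isAddFundamentalDomain_cell.integral_eq_tsum'' _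
        (h_loc.integrable_smul_right_of_hasCompactSupport hh hc)).symm

end Periodization

/-! ### Weak gradients -/

instance (D : Dom) : IsLocallyFiniteMeasure (vol D d) := by
  cases D with
  | line => exact inferInstanceAs (IsLocallyFiniteMeasure (volume : Measure (Sp d)))
  | torus => infer_instance

lemma IsCc.integrable_smul {D : Dom} {F : Type} [NormedAddCommGroup F] [NormedSpace ℝ F]
    {q : Sp d → ℝ} (hq : IsCc D q) {h : Sp d → F} (hh : LocallyIntegrable h (vol D d)) :
    Integrable (fun x => q x • h x) (vol D d) := by
  cases D with
  | line => exact hh.integrable_smul_left_of_hasCompactSupport hq.continuous (hq.compact rfl)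
  | torus => exact integrable_vol_torus (hh.continuous_smul hq.continuous)

section WeakGradient

variable {D : Dom} {φ : Sp d → ℝ} {G : Sp d → Sp d}

lemma IsWeakGrad.to_line (h : IsWeakGrad D φ G) : IsWeakGrad Dom.line φ G := by
  cases D with
  | line => exact h
  | torus =>
    have hφ := integrable_vol_torus h.locInt_fun
    have hG := integrable_vol_torus h.locInt_grad
    refine ⟨trivial, trivial, h.isOn_fun.locallyIntegrable hφ, h.isOn_grad.locallyIntegrable hG,
      fun ξ hξ i => ?_⟩
    have h_parts := h.parts _ hξ.periodization i
    simp only [gradient_apply, hξ.fderiv_periodization] at h_parts ⊢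
    have hξ' := hξ.fderiv_apply (EuclideanSpace.single i 1)
    rwa [vol_torus, setIntegral_cell_mul_periodization h.isOn_fun hφ hξ'.isCc.continuous
        (hξ'.compact rfl),
      setIntegral_cell_mul_periodization (h.isOn_grad.comp fun v => v i) (hG.eval_piLp i)
        hξ.isCc.continuous (hξ.compact rfl)] at h_parts

lemma IsWeakGrad.integral_mul_fderiv (h : IsWeakGrad D φ G) {ξ : Sp d → ℝ} (hξ : IsTest D ξ)
    (i : Fin d) : ∫ x, φ x * fderiv ℝ ξ x (EuclideanSpace.single i 1) ∂(vol D d) =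
      -∫ x, G x i * ξ x ∂(vol D d) := by
  simpa only [gradient_apply] using h.parts ξ hξ i

lemma IsWeakGrad.gradient_convolution (h : IsWeakGrad Dom.line φ G) {e : Sp d → ℝ}
    (he : IsTest Dom.line e) (x : Sp d) :
    gradient (e ⋆[.lsmul ℝ ℝ, volume] φ) x = (e ⋆[.lsmul ℝ ℝ, volume] G) x := by
  ext i
  let v : Sp d := EuclideanSpace.single i 1
  have hec := he.compact rfl
  have hes := he.smooth.contDiff
  have h_flip : IsTest Dom.line fun y => e (x - y) :=
    ⟨⟨trivial, hes.comp (contDiff_const.sub contDiff_id)⟩,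
      fun _ => hec.comp_homeomorph (Homeomorph.subLeft x)⟩
  have h_fderiv (y : Sp d) : HasFDerivAt (fun y => e (x - y)) (-fderiv ℝ e (x - y)) y := by
    simpa only [ContinuousLinearMap.comp_neg, ContinuousLinearMap.comp_id] using!
      (hes.differentiable (by simp) (x - y)).hasFDerivAt.comp y ((hasFDerivAt_id y).const_sub x)
  have h_parts := h.integral_mul_fderiv h_flip i
  simp only [(h_fderiv _).fderiv, neg_apply, mul_neg, integral_neg, neg_inj] at h_parts
  have h_loc : LocallyIntegrable φ volume := h.locInt_fun
  have h_int : Integrable (fun y => e (x - y) • G y) volume :=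
    h.locInt_grad.integrable_smul_left_of_hasCompactSupport h_flip.isCc.continuous
      (h_flip.compact rfl)
  calc gradient (e ⋆[.lsmul ℝ ℝ, volume] φ) x i
      = ((fun y => fderiv ℝ e y v) ⋆[.lsmul ℝ ℝ, volume] φ) x := by
        rw [gradient_apply, ← convolution_flip, HasFDerivAt.fderiv
            (hec.hasFDerivAt_convolution_right _ h_loc (hes.of_le (by simp)) x),
          convolution_precompR_apply _ h_loc (hec.fderiv ℝ)
            (hes.continuous_fderiv (by simp)), convolution_flip]
    _ = ∫ y, φ y * fderiv ℝ e (x - y) v := by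
        simp only [convolution_lsmul_swap, smul_eq_mul, mul_comm]
    _ = ∫ y, G y i * e (x - y) := h_parts
    _ = (e ⋆[.lsmul ℝ ℝ, volume] G) x i := by
        rw [convolution_lsmul_swap, eval_integral_piLp fun i => h_int.eval_piLp i]
        simp only [PiLp.smul_apply, smul_eq_mul, mul_comm]

lemma IsWeakGrad.smooth_mul (h : IsWeakGrad D φ G) {χ : Sp d → ℝ} (hχ : IsSmooth D χ) :
    IsWeakGrad D (fun x => χ x * φ x) fun x => χ x • G x + φ x • gradient χ x where
  isOn_fun := hχ.isOn.comp₂ h.isOn_fun (· * ·)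
  isOn_grad := (hχ.isOn.comp₂ h.isOn_grad (· • ·)).comp₂
    (h.isOn_fun.comp₂ hχ.isOn.gradient (· • ·)) (· + ·)
  locInt_fun := h.locInt_fun.continuous_smul hχ.contDiff.continuous
  locInt_grad := (h.locInt_grad.continuous_smul hχ.contDiff.continuous).add
    (h.locInt_fun.smul_continuous (continuous_gradient hχ.contDiff))
  parts ξ hξ i := by
    have h_parts := h.parts _ (hξ.mul_left hχ) i
    have h_left := ((hξ.gradient_apply i).mul_left hχ).isCc.integrable_smul h.locInt_fun
    have h_right := (hξ.mul_left hχ).isCc.integrable_smul h.locInt_grad |>.eval_piLp i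
    have h_chi := (hξ.isCc.mul_right (continuous_gradient_apply hχ.contDiff i)
      (hχ.isOn.gradient.comp fun v => v i)).integrable_smul h.locInt_fun
    have h_test : ∫ x, φ x * gradient (fun y => χ y * ξ y) x i ∂(vol D d) =
        (∫ x, χ x * φ x * gradient ξ x i ∂(vol D d)) +
          ∫ x, φ x * gradient χ x i * ξ x ∂(vol D d) := by
      rw [← integral_add (h_left.congr (.of_forall fun x => by simp only [smul_eq_mul]; ring))
        (h_chi.congr (.of_forall fun x => by simp only [smul_eq_mul]; ring))]
      refine integral_congr_ae (.of_forall fun x => ?_)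
      simp only [gradient_mul hχ.contDiff hξ.smooth.contDiff, PiLp.add_apply, PiLp.smul_apply,
        smul_eq_mul]
      ring
    have h_grad : ∫ x, (χ x • G x + φ x • gradient χ x) i * ξ x ∂(vol D d) =
        (∫ x, G x i * (χ x * ξ x) ∂(vol D d)) + ∫ x, φ x * gradient χ x i * ξ x ∂(vol D d) := by
      rw [← integral_add (h_right.congr (.of_forall fun x => by
          simp only [PiLp.smul_apply, smul_eq_mul]; ring))
        (h_chi.congr (.of_forall fun x => by simp only [smul_eq_mul]; ring))]
      refine integral_congr_ae (.of_forall fun x => ?_)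
      simp only [PiLp.add_apply, PiLp.smul_apply, smul_eq_mul]
      ring
    linarith

end WeakGradient

/-! ### Integration by parts -/

lemma IsCc.exists_bound {D : Dom} {q : Sp d → ℝ} (hq : IsCc D q) : ∃ C, ∀ x, ‖q x‖ ≤ C := by
  cases D with
  | line => exact hq.continuous.bounded_above_of_compact_support (hq.compact rfl)
  | torus => exact hq.isOn.exists_bound_of_continuous hq.continuous

lemma IsCc.integrable {D : Dom} {q : Sp d → ℝ} (hq : IsCc D q) : Integrable q (vol D d) := by
  simpa only [smul_eq_mul, mul_one] using
    hq.integrable_smul (locallyIntegrable_const (1 : ℝ) (μ := vol D d))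

lemma IsTest.integral_fderiv_torus {ξ : Sp d → ℝ} (hξ : IsTest Dom.torus ξ) (v : Sp d) :
    ∫ x, fderiv ℝ ξ x v ∂(vol Dom.torus d) = 0 := by
  have hv := (hξ.fderiv_apply v).isCc
  obtain ⟨C, hC⟩ := hv.exists_bound
  have h_line (t : ℝ) (x : Sp d) :
      HasDerivAt (fun t : ℝ => ξ (t • v + x)) (fderiv ℝ ξ (t • v + x) v) t := by
    have h_path : HasDerivAt (fun t : ℝ => t • v + x) v t := by
      simpa only [id_eq, one_smul] using! ((hasDerivAt_id t).smul_const v).add_const x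
    exact (hξ.smooth.contDiff.differentiable (by simp) _).hasFDerivAt.comp_hasDerivAt t h_path
  have h_cont (t : ℝ) : Continuous fun x => ξ (t • v + x) :=
    hξ.isCc.continuous.comp (continuous_const_add _)
  have h_deriv := (hasDerivAt_integral_of_dominated_loc_of_deriv_le (μ := vol Dom.torus d)
    (F := fun (t : ℝ) x => ξ (t • v + x)) (bound := fun _ => C) univ_mem
    (Eventually.of_forall fun t => (h_cont t).aestronglyMeasurable)
    (integrable_vol_torus (h_cont 0).locallyIntegrable)
    (hv.continuous.comp (continuous_const_add _)).aestronglyMeasurable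
    (Eventually.of_forall fun x t _ => hC _) (integrable_const C)
    (Eventually.of_forall fun x t _ => h_line t x)).2
  simp only [vol_torus, hξ.smooth.isOn.setIntegral_cell_comp_add, zero_smul, zero_add] at h_deriv
  exact h_deriv.unique (hasDerivAt_const _ _)

lemma IsTest.integral_fderiv {D : Dom} {ξ : Sp d → ℝ} (hξ : IsTest D ξ) (v : Sp d) :
    ∫ x, fderiv ℝ ξ x v ∂(vol D d) = 0 := by
  cases D with
  | torus => exact hξ.integral_fderiv_torus v
  | line =>
    have h_int : Integrable ξ volume := hξ.isCc.integrable
    have h_int' : Integrable (fun x => fderiv ℝ ξ x v) volume := (hξ.fderiv_apply v).isCc.integrable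
    have h_parts := integral_mul_fderiv_eq_neg_fderiv_mul_of_integrable
      (μ := (volume : Measure (Sp d))) (f := fun _ => (1 : ℝ)) (g := ξ) (v := v) (by simp)
      (by simpa only [one_mul] using h_int') (by simpa only [one_mul] using h_int)
      (fun x _ => differentiableAt_const _)
      (fun x _ => hξ.smooth.contDiff.differentiable (by simp) x)
    simpa only [vol, fderiv_fun_const, Pi.zero_apply, zero_apply, zero_mul, integral_zero,
      neg_zero, one_mul] using h_parts

lemma IsTest.isWeakGrad {D : Dom} {ξ : Sp d → ℝ} (hξ : IsTest D ξ) :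
    IsWeakGrad D ξ (gradient ξ) where
  isOn_fun := hξ.smooth.isOn
  isOn_grad := hξ.smooth.isOn.gradient
  locInt_fun := hξ.isCc.continuous.locallyIntegrable
  locInt_grad := (continuous_gradient hξ.smooth.contDiff).locallyIntegrable
  parts ζ hζ i := by
    have h_zero := (hζ.mul_left hξ.smooth).integral_fderiv (EuclideanSpace.single i 1)
    simp only [← AsymVar.gradient_apply, gradient_mul hξ.smooth.contDiff hζ.smooth.contDiff,
      PiLp.add_apply, PiLp.smul_apply, smul_eq_mul] at h_zero
    rw [integral_add ((hζ.gradient_apply i).mul_left hξ.smooth).isCc.integrable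
      (hζ.isCc.mul_right (continuous_gradient_apply hξ.smooth.contDiff i)
        (hξ.smooth.isOn.gradient.comp fun v => v i)).integrable] at h_zero
    simp only [mul_comm (gradient ξ _ i)]
    exact eq_neg_of_add_eq_zero_left h_zero

lemma IsWeakGrad.const {D : Dom} (c : ℝ) : IsWeakGrad D (fun _ : Sp d => c) fun _ => 0 where
  isOn_fun := .const c
  isOn_grad := .const 0
  locInt_fun := locallyIntegrable_const c
  locInt_grad := locallyIntegrable_const 0
  parts ξ hξ i := by
    simp only [gradient_apply, integral_const_mul, hξ.integral_fderiv, mul_zero, PiLp.zero_apply,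
      zero_mul, integral_zero, neg_zero]

lemma IsWeakGrad.sub {D : Dom} {φ ψ : Sp d → ℝ} {G H : Sp d → Sp d} (hφ : IsWeakGrad D φ G)
    (hψ : IsWeakGrad D ψ H) : IsWeakGrad D (fun x => φ x - ψ x) fun x => G x - H x where
  isOn_fun := hφ.isOn_fun.comp₂ hψ.isOn_fun (· - ·)
  isOn_grad := hφ.isOn_grad.comp₂ hψ.isOn_grad (· - ·)
  locInt_fun := hφ.locInt_fun.sub hψ.locInt_fun
  locInt_grad := hφ.locInt_grad.sub hψ.locInt_grad
  parts ξ hξ i := by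
    have h_int {φ : Sp d → ℝ} (h : LocallyIntegrable φ (vol D d)) :
        Integrable (fun x => φ x * gradient ξ x i) (vol D d) := by
      simpa only [smul_eq_mul, mul_comm] using (hξ.gradient_apply i).isCc.integrable_smul h
    have h_int' {G : Sp d → Sp d} (h : LocallyIntegrable G (vol D d)) :
        Integrable (fun x => G x i * ξ x) (vol D d) := by
      simpa only [PiLp.smul_apply, smul_eq_mul, mul_comm] using
        (hξ.isCc.integrable_smul h).eval_piLp i
    simp only [PiLp.sub_apply, sub_mul]
    rw [integral_sub (h_int hφ.locInt_fun) (h_int hψ.locInt_fun),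
      integral_sub (h_int' hφ.locInt_grad) (h_int' hψ.locInt_grad), hφ.parts ξ hξ i,
      hψ.parts ξ hξ i]
    ring

/-! ### Gibbs measures -/

/-- Potentials with a finite normalization constant: `W` is continuous on `𝔻^d` and `e^{-W}` is
Lebesgue integrable. -/
structure IsPotential (D : Dom) (W : Sp d → ℝ) : Prop where
  isOn : IsOn D W
  continuous : Continuous W
  integrable_exp : Integrable (fun x => Real.exp (-W x)) (vol D d)

/-- The Lebesgue density `e^{-W} / ∫ e^{-W}` of `gibbs D W`. -/
def gibbsDensity (D : Dom) (W : Sp d → ℝ) (x : Sp d) : ℝ := Real.exp (-W x) / Zc D W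

lemma gibbs_eq_withDensity (D : Dom) (W : Sp d → ℝ) :
    gibbs D W = (vol D d).withDensity fun x => ENNReal.ofReal (gibbsDensity D W x) := rfl

lemma gibbs_absolutelyContinuous (D : Dom) (W : Sp d → ℝ) : gibbs D W ≪ vol D d :=
  withDensity_absolutelyContinuous _ _

instance (D : Dom) : NeZero (vol D d) := by
  cases D with
  | line => exact inferInstanceAs (NeZero (volume : Measure (Sp d)))
  | torus =>
    refine ⟨fun h => isAddFundamentalDomain_cell.measure_ne_zero
      (NeZero.ne (volume : Measure (Sp d))) ?_⟩
    rwa [vol_torus, Measure.restrict_eq_zero] at h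

lemma IsOn.locallyL2 {F : Type} [NormedAddCommGroup F] {h : Sp d → F} (hh : IsOn Dom.torus h)
    (h_loc : LocallyL2 h (vol Dom.torus d)) : LocallyL2 h volume := by
  have hL2 : MemLp h 2 (vol Dom.torus d) := by
    simpa only [vol_torus, Measure.restrict_restrict_of_subset subset_rfl] using
      h_loc.memLp_restrict (isBounded_cell (d := d))
  have h_meas := (hh.locallyIntegrable (hL2.integrable (by norm_num))).aestronglyMeasurable
  intro K hK
  rw [memLp_two_iff_integrable_sq_norm h_meas.restrict]
  exact ((hh.comp fun v => ‖v‖ ^ 2).locallyIntegrable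
    (hL2.integrable_norm_pow two_ne_zero)).integrableOn_isCompact hK

namespace IsPotential

variable {D : Dom} {W : Sp d → ℝ}

lemma Zc_pos (hW : IsPotential D W) : 0 < Zc D W := integral_exp_pos hW.integrable_exp

lemma density_pos (hW : IsPotential D W) (x : Sp d) : 0 < gibbsDensity D W x :=
  div_pos (Real.exp_pos _) hW.Zc_pos

lemma continuous_density (hW : IsPotential D W) : Continuous (gibbsDensity D W) :=
  (Real.continuous_exp.comp hW.continuous.neg).div_const _

lemma isOn_density (hW : IsPotential D W) : IsOn D (gibbsDensity D W) :=
  hW.isOn.comp fun w => Real.exp (-w) / Zc D W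

lemma continuous_inv_density (hW : IsPotential D W) : Continuous (gibbsDensity D W)⁻¹ :=
  hW.continuous_density.inv₀ fun x => (hW.density_pos x).ne'

lemma measurable_ofReal_density (hW : IsPotential D W) :
    Measurable fun x => ENNReal.ofReal (gibbsDensity D W x) :=
  hW.continuous_density.measurable.ennreal_ofReal

section

variable {F : Type*} [NormedAddCommGroup F] [NormedSpace ℝ F]

lemma integral_gibbs (hW : IsPotential D W) (h : Sp d → F) :
    ∫ x, h x ∂(gibbs D W) = ∫ x, gibbsDensity D W x • h x ∂(vol D d) := by
  rw [gibbs_eq_withDensity,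
    integral_withDensity_eq_integral_toReal_smul hW.measurable_ofReal_density
      (.of_forall fun _ => ENNReal.ofReal_lt_top)]
  exact integral_congr_ae (.of_forall fun x =>
    congrArg (· • h x) (ENNReal.toReal_ofReal (hW.density_pos x).le))

lemma integrable_gibbs_iff (hW : IsPotential D W) {h : Sp d → F} :
    Integrable h (gibbs D W) ↔ Integrable (fun x => gibbsDensity D W x • h x) (vol D d) := by
  rw [gibbs_eq_withDensity, integrable_withDensity_iff_integrable_smul' hW.measurable_ofReal_density
    (.of_forall fun _ => ENNReal.ofReal_lt_top)]
  exact integrable_congr (.of_forall fun x =>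
    congrArg (· • h x) (ENNReal.toReal_ofReal (hW.density_pos x).le))

end

lemma Zc_mul_integral_gibbs (hW : IsPotential D W) (h : Sp d → ℝ) :
    Zc D W * ∫ x, h x ∂(gibbs D W) = ∫ x, Real.exp (-W x) * h x ∂(vol D d) := by
  rw [hW.integral_gibbs, ← integral_const_mul]
  refine integral_congr_ae (.of_forall fun x => ?_)
  simp only [gibbsDensity, smul_eq_mul]
  field_simp [hW.Zc_pos.ne']

lemma isProbabilityMeasure (hW : IsPotential D W) : IsProbabilityMeasure (gibbs D W) := by
  have : IsFiniteMeasure (gibbs D W) :=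
    isFiniteMeasure_withDensity_ofReal (hW.integrable_exp.div_const _).2
  have h_mass : Zc D W * (gibbs D W).real Set.univ = Zc D W := by
    simpa only [integral_const, smul_eq_mul, mul_one] using! hW.Zc_mul_integral_gibbs fun _ => 1
  refine ⟨(ENNReal.toReal_eq_one_iff _).1 ?_⟩
  exact mul_left_cancel₀ hW.Zc_pos.ne' (h_mass.trans (mul_one _).symm)

lemma vol_absolutelyContinuous (hW : IsPotential D W) : vol D d ≪ gibbs D W :=
  withDensity_absolutelyContinuous' hW.measurable_ofReal_density.aemeasurable
    (.of_forall fun x => (ENNReal.ofReal_pos.2 (hW.density_pos x)).ne')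

lemma locallyL2_vol (hW : IsPotential D W) {F : Type*} [NormedAddCommGroup F] {h : Sp d → F}
    (hh : MemLp h 2 (gibbs D W)) : LocallyL2 h (vol D d) := by
  have h_sq := hW.integrable_gibbs_iff.1 (hh.integrable_norm_pow two_ne_zero)
  have h_sq_loc := h_sq.locallyIntegrable.continuous_smul hW.continuous_inv_density
  simp only [Pi.inv_apply, inv_smul_smul₀ (hW.density_pos _).ne'] at h_sq_loc
  intro K hK
  rw [memLp_two_iff_integrable_sq_norm (hh.1.mono_ac hW.vol_absolutelyContinuous).restrict]
  exact h_sq_loc.integrableOn_isCompact hK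

lemma locallyL2 (hW : IsPotential D W) {F : Type} [NormedAddCommGroup F] {h : Sp d → F}
    (h_on : IsOn D h) (hh : MemLp h 2 (gibbs D W)) : LocallyL2 h volume := by
  cases D with
  | line => exact hW.locallyL2_vol hh
  | torus => exact h_on.locallyL2 (hW.locallyL2_vol hh)

end IsPotential

section

variable {D : Dom} {W : Sp d → ℝ}

lemma IsCc.memLp_gibbs {q : Sp d → ℝ} (hq : IsCc D q) (hW : IsPotential D W) (p : ENNReal) :
    MemLp q p (gibbs D W) := by
  have := hW.isProbabilityMeasure
  obtain ⟨C, hC⟩ := hq.exists_bound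
  exact .of_bound hq.continuous.aestronglyMeasurable C (.of_forall hC)

lemma IsTest.memH1 {ξ : Sp d → ℝ} (hξ : IsTest D ξ) (hW : IsPotential D W) :
    MemH1 D (gibbs D W) ξ (gradient ξ) where
  weakGrad := hξ.isWeakGrad
  memLp_fun := hξ.isCc.memLp_gibbs hW 2
  memLp_grad := .of_eval_piLp fun i => (hξ.gradient_apply i).isCc.memLp_gibbs hW 2

lemma memH1_const {m : Measure (Sp d)} [IsFiniteMeasure m] (c : ℝ) :
    MemH1 D m (fun _ => c) fun _ => 0 where
  weakGrad := .const c
  memLp_fun := memLp_const c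
  memLp_grad := memLp_const 0

lemma MemH1.sub {m : Measure (Sp d)} {φ ψ : Sp d → ℝ} {G H : Sp d → Sp d} (hφ : MemH1 D m φ G)
    (hψ : MemH1 D m ψ H) : MemH1 D m (fun x => φ x - ψ x) fun x => G x - H x where
  weakGrad := hφ.weakGrad.sub hψ.weakGrad
  memLp_fun := hφ.memLp_fun.sub hψ.memLp_fun
  memLp_grad := hφ.memLp_grad.sub hψ.memLp_grad

lemma MemH1.sub_const {m : Measure (Sp d)} [IsFiniteMeasure m] {φ : Sp d → ℝ} {G : Sp d → Sp d}
    (hφ : MemH1 D m φ G) (c : ℝ) : MemH1 D m (fun x => φ x - c) G := by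
  simpa only [sub_zero] using hφ.sub (memH1_const c)

end

/-! ### Testing a weak equation against Sobolev functions -/

/-- Smooth bump functions shrinking to the origin; convolution with their normalizations is the
mollification. -/
def mollifier (d n : ℕ) : ContDiffBump (0 : Sp d) where
  rIn := 1 / (n + 1)
  rOut := 2 * (1 / (n + 1))
  rIn_pos := by positivity
  rIn_lt_rOut := by linarith [show (0 : ℝ) < 1 / (n + 1) by positivity]

lemma tendsto_rOut_mollifier : Tendsto (fun n => (mollifier d n).rOut) atTop (𝓝 0) := by
  simpa only [mul_zero] using! tendsto_one_div_add_atTop_nhds_zero_nat.const_mul (2 : ℝ)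

lemma isTest_normed_mollifier (n : ℕ) : IsTest Dom.line ((mollifier d n).normed volume) :=
  ⟨⟨trivial, (mollifier d n).contDiff_normed⟩, fun _ => (mollifier d n).hasCompactSupport_normed⟩

lemma tendsto_integral_inner_mollification {D : Dom} {F : Type*} [NormedAddCommGroup F]
    [InnerProductSpace ℝ F] [CompleteSpace F] {f g : Sp d → F} (hf : LocallyL2 f volume)
    (hg : LocallyL2 g volume) (hgc : D = Dom.line → HasCompactSupport g) :
    Tendsto (fun n => ∫ x, inner ℝ (f x)
      (((mollifier d n).normed volume ⋆[.lsmul ℝ ℝ, volume] g) x) ∂(vol D d)) atTop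
      (𝓝 (∫ x, inner ℝ (f x) (g x) ∂(vol D d))) := by
  cases D with
  | line =>
    exact tendsto_integral_inner_convolution_normed_of_hasCompactSupport hf hg (hgc rfl)
      tendsto_rOut_mollifier
  | torus =>
    exact tendsto_setIntegral_inner_convolution_normed measurableSet_cell isBounded_cell
      (hf.memLp_restrict isBounded_cell) hg tendsto_rOut_mollifier

lemma integrable_inner_of_memLp {X F : Type*} [MeasurableSpace X] {m : Measure X}
    [NormedAddCommGroup F] [InnerProductSpace ℝ F] {G H : X → F} (hG : MemLp G 2 m)
    (hH : MemLp H 2 m) : Integrable (fun x => inner ℝ (G x) (H x)) m := by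
  refine (L2.integrable_inner (𝕜 := ℝ) (hG.toLp G) (hH.toLp H)).congr ?_
  filter_upwards [hG.coeFn_toLp, hH.coeFn_toLp] with x hGx hHx
  rw [hGx, hHx]

section Testing

variable {D : Dom} {ψ : Sp d → ℝ} {H : Sp d → Sp d}

lemma IsWeakGrad.isTest_convolution (h : IsWeakGrad D ψ H) (hc : D = Dom.line → HasCompactSupport ψ)
    {e : Sp d → ℝ} (he : IsTest Dom.line e) : IsTest D (e ⋆[.lsmul ℝ ℝ, volume] ψ) where
  smooth := ⟨h.isOn_fun.convolution e, (he.compact rfl).contDiff_convolution_left _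
    he.smooth.contDiff h.to_line.locInt_fun⟩
  compact hD := (he.compact rfl).convolution _ (hc hD)

/-- The functions `A` and `a` satisfy `-∇ · A = a` in the sense of distributions on `𝔻^d`. -/
def IsWeakDiv (D : Dom) (A : Sp d → Sp d) (a : Sp d → ℝ) : Prop :=
  ∀ ξ : Sp d → ℝ, IsTest D ξ →
    ∫ x, inner ℝ (A x) (gradient ξ x) ∂(vol D d) = ∫ x, a x * ξ x ∂(vol D d)

variable {A : Sp d → Sp d} {a : Sp d → ℝ}

lemma IsWeakDiv.integral_inner_of_hasCompactSupport (hA : IsWeakDiv D A a)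
    (hAL : LocallyL2 A volume) (haL : LocallyL2 a volume) (h : IsWeakGrad D ψ H)
    (hψ : LocallyL2 ψ volume) (hH : LocallyL2 H volume)
    (hψc : D = Dom.line → HasCompactSupport ψ) (hHc : D = Dom.line → HasCompactSupport H) :
    ∫ x, inner ℝ (A x) (H x) ∂(vol D d) = ∫ x, a x * ψ x ∂(vol D d) := by
  have h_lim := tendsto_integral_inner_mollification hAL hH hHc
  have h_lim' := tendsto_integral_inner_mollification haL hψ hψc
  simp only [← h.to_line.gradient_convolution (isTest_normed_mollifier _),
    hA _ (h.isTest_convolution hψc (isTest_normed_mollifier _))] at h_lim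
  simp only [RCLike.inner_apply, conj_trivial, mul_comm _ (a _)] at h_lim'
  exact tendsto_nhds_unique h_lim h_lim'

/-- Smooth functions with compact support which tend to `1`, with gradients of order `1/n`. -/
def cutoff (d n : ℕ) (x : Sp d) : ℝ :=
  (⟨1, 2, one_pos, one_lt_two⟩ : ContDiffBump (0 : Sp d)) ((1 / (n + 1) : ℝ) • x)

lemma isTest_cutoff (n : ℕ) : IsTest Dom.line (cutoff d n) :=
  ⟨⟨trivial, (ContDiffBump.contDiff _).comp (contDiff_id.const_smul _)⟩,
    fun _ => (ContDiffBump.hasCompactSupport _).comp_smul (by positivity)⟩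

lemma norm_cutoff_le_one (n : ℕ) (x : Sp d) : ‖cutoff d n x‖ ≤ 1 := by
  rw [cutoff, Real.norm_of_nonneg (ContDiffBump.nonneg _)]
  exact ContDiffBump.le_one _

lemma tendsto_cutoff (x : Sp d) : Tendsto (fun n => cutoff d n x) atTop (𝓝 1) := by
  let b : ContDiffBump (0 : Sp d) := ⟨1, 2, one_pos, one_lt_two⟩
  have h_zero : Tendsto (fun n : ℕ => (1 / (n + 1) : ℝ) • x) atTop (𝓝 0) := by
    simpa only [zero_smul] using (tendsto_one_div_add_atTop_nhds_zero_nat (𝕜 := ℝ)).smul_const x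
  have h_one : b 0 = 1 := b.one_of_mem_closedBall (Metric.mem_closedBall_self b.rIn_pos.le)
  exact h_one ▸ (b.continuous.tendsto 0).comp h_zero

lemma exists_norm_gradient_cutoff_le (d : ℕ) :
    ∃ M, ∀ n x, ‖gradient (cutoff d n) x‖ ≤ M * (1 / (n + 1)) := by
  let b : ContDiffBump (0 : Sp d) := ⟨1, 2, one_pos, one_lt_two⟩
  have h_cont : Continuous (fderiv ℝ b) := b.contDiff.continuous_fderiv (n := ∞) (by simp)
  obtain ⟨M, hM⟩ := h_cont.bounded_above_of_compact_support (b.hasCompactSupport.fderiv ℝ)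
  refine ⟨M, fun n x => ?_⟩
  have h_fderiv : fderiv ℝ (cutoff d n) x =
      (1 / (n + 1) : ℝ) • fderiv ℝ b ((1 / (n + 1) : ℝ) • x) := fderiv_comp_smul ..
  rw [gradient, LinearIsometryEquiv.norm_map, h_fderiv, norm_smul, mul_comm,
    Real.norm_of_nonneg (by positivity)]
  gcongr
  exact hM _

lemma hasCompactSupport_gradient {χ : Sp d → ℝ} (hχ : HasCompactSupport χ) :
    HasCompactSupport (gradient χ) :=
  (hχ.fderiv ℝ).comp_left (map_zero _)

lemma tendsto_gradient_cutoff (x : Sp d) :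
    Tendsto (fun n => gradient (cutoff d n) x) atTop (𝓝 0) := by
  obtain ⟨M, hM⟩ := exists_norm_gradient_cutoff_le d
  refine squeeze_zero_norm (fun n => hM n x) ?_
  simpa only [mul_zero] using tendsto_one_div_add_atTop_nhds_zero_nat.const_mul M

lemma tendsto_integral_cutoff_smul {F : Type*} [NormedAddCommGroup F] [NormedSpace ℝ F]
    {h : Sp d → F} (hh : Integrable h) :
    Tendsto (fun n => ∫ x, cutoff d n x • h x) atTop (𝓝 (∫ x, h x)) := by
  refine tendsto_integral_of_dominated_convergence (fun x => ‖h x‖)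
    (fun n => (isTest_cutoff n).isCc.continuous.aestronglyMeasurable.smul hh.1) hh.norm
    (fun n => .of_forall fun x => ?_) (.of_forall fun x => ?_)
  · rw [norm_smul]
    exact mul_le_of_le_one_left (norm_nonneg _) (norm_cutoff_le_one n x)
  · simpa only [one_smul] using (tendsto_cutoff x).smul_const (h x)

lemma tendsto_integral_inner_gradient_cutoff {h : Sp d → Sp d} (hh : Integrable h) :
    Tendsto (fun n => ∫ x, inner ℝ (h x) (gradient (cutoff d n) x)) atTop (𝓝 0) := by
  obtain ⟨M, hM⟩ := exists_norm_gradient_cutoff_le d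
  rw [← integral_zero (Sp d) ℝ]
  refine tendsto_integral_of_dominated_convergence (fun x => ‖h x‖ * M) (fun n => hh.1.inner
      (continuous_gradient (isTest_cutoff n).smooth.contDiff).aestronglyMeasurable)
    (hh.norm.mul_const M) (fun n => .of_forall fun x => ?_) (.of_forall fun x => ?_)
  · have hM_nonneg : 0 ≤ M := by simpa using (norm_nonneg _).trans (hM 0 0)
    refine (norm_inner_le_norm _ _).trans ?_
    gcongr
    refine (hM n x).trans (mul_le_of_le_one_right hM_nonneg ?_)
    exact div_le_one_of_le₀ (by linarith [n.cast_nonneg (α := ℝ)]) (by positivity)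
  · simpa only [inner_zero_right] using tendsto_const_nhds.inner (tendsto_gradient_cutoff x)

lemma IsWeakDiv.integral_cutoff_smul {A : Sp d → Sp d} (hA : IsWeakDiv Dom.line A a)
    (hAL : LocallyL2 A volume) (haL : LocallyL2 a volume) (h : IsWeakGrad Dom.line ψ H)
    (hψ : LocallyL2 ψ volume) (hH : LocallyL2 H volume)
    (hAH : Integrable fun x => inner ℝ (A x) (H x)) (hψA : Integrable fun x => ψ x • A x) (n : ℕ) :
    (∫ x, cutoff d n x • inner ℝ (A x) (H x)) +
        ∫ x, inner ℝ (ψ x • A x) (gradient (cutoff d n) x) =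
      ∫ x, cutoff d n x • (a x * ψ x) := by
  have hχ := isTest_cutoff (d := d) n
  have hχ_cont := hχ.isCc.continuous
  have h_grad := continuous_gradient hχ.smooth.contDiff
  have h_grad_supp := hasCompactSupport_gradient (hχ.compact rfl)
  have h_int : Integrable fun x => cutoff d n x • inner ℝ (A x) (H x) :=
    hAH.bdd_smul 1 hχ_cont.aestronglyMeasurable (.of_forall (norm_cutoff_le_one n))
  have h_int' : Integrable fun x => inner ℝ (ψ x • A x) (gradient (cutoff d n) x) := by
    obtain ⟨C, hC⟩ := h_grad.bounded_above_of_compact_support h_grad_supp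
    refine (hψA.norm.mul_const C).mono' (hψA.1.inner h_grad.aestronglyMeasurable)
      (.of_forall fun x => (norm_inner_le_norm _ _).trans ?_)
    gcongr
    exact hC x
  rw [← integral_add h_int h_int']
  have hH' : LocallyL2 (fun x => cutoff d n x • H x + ψ x • gradient (cutoff d n) x) volume :=
    fun K hK => (hH.continuous_smul hχ_cont K hK).add (hψ.smul_continuous h_grad K hK)
  have h_supp : HasCompactSupport fun x => cutoff d n x • H x + ψ x • gradient (cutoff d n) x :=
    ((hχ.compact rfl).smul_right (f' := H)).add (h_grad_supp.smul_left (f := ψ))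
  have h_test := hA.integral_inner_of_hasCompactSupport hAL haL (h.smooth_mul hχ.smooth)
    (hψ.continuous_smul hχ_cont) hH' (fun _ => (hχ.compact rfl).mul_right) fun _ => h_supp
  simp only [inner_add_right, real_inner_smul_right, mul_left_comm (a _)] at h_test
  simpa only [real_inner_smul_left, smul_eq_mul] using! h_test

lemma IsWeakDiv.integral_inner (hA : IsWeakDiv D A a) (hAL : LocallyL2 A volume)
    (haL : LocallyL2 a volume) (h : IsWeakGrad D ψ H) (hψ : LocallyL2 ψ volume)
    (hH : LocallyL2 H volume) (hAH : Integrable (fun x => inner ℝ (A x) (H x)) (vol D d))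
    (hψA : Integrable (fun x => ψ x • A x) (vol D d))
    (haψ : Integrable (fun x => a x * ψ x) (vol D d)) :
    ∫ x, inner ℝ (A x) (H x) ∂(vol D d) = ∫ x, a x * ψ x ∂(vol D d) := by
  cases D with
  | torus => exact hA.integral_inner_of_hasCompactSupport hAL haL h hψ hH nofun nofun
  | line =>
    have h_lim :=
      (tendsto_integral_cutoff_smul hAH).add (tendsto_integral_inner_gradient_cutoff hψA)
    simp only [hA.integral_cutoff_smul hAL haL h hψ hH hAH hψA, add_zero] at h_lim
    exact tendsto_nhds_unique h_lim (tendsto_integral_cutoff_smul haψ)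

lemma MemH1.integral_inner_eq {W : Sp d → ℝ} (hψ : MemH1 D (gibbs D W) ψ H) (hW : IsPotential D W)
    {G : Sp d → Sp d} {g : Sp d → ℝ} (hG_on : IsOn D G) (hG : MemLp G 2 (gibbs D W))
    (hg_on : IsOn D g) (hg : MemLp g 2 (gibbs D W))
    (h_eq : ∀ ξ : Sp d → ℝ, IsTest D ξ →
      ∫ x, inner ℝ (G x) (gradient ξ x) ∂(gibbs D W) = ∫ x, g x * ξ x ∂(gibbs D W)) :
    ∫ x, inner ℝ (G x) (H x) ∂(gibbs D W) = ∫ x, g x * ψ x ∂(gibbs D W) := by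
  have h_div : IsWeakDiv D (fun x => gibbsDensity D W x • G x)
      fun x => gibbsDensity D W x • g x := fun ξ hξ => by
    simpa only [hW.integral_gibbs, real_inner_smul_left, smul_eq_mul, mul_assoc] using h_eq ξ hξ
  have h_test := h_div.integral_inner
    ((hW.locallyL2 hG_on hG).continuous_smul hW.continuous_density)
    ((hW.locallyL2 hg_on hg).continuous_smul hW.continuous_density) hψ.weakGrad
    (hW.locallyL2 hψ.weakGrad.isOn_fun hψ.memLp_fun)
    (hW.locallyL2 hψ.weakGrad.isOn_grad hψ.memLp_grad)
    (by simpa only [real_inner_smul_left] using!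
      hW.integrable_gibbs_iff.1 (integrable_inner_of_memLp hG hψ.memLp_grad))
    (by simpa only [Pi.smul_apply', smul_comm (gibbsDensity D W _)] using!
      hW.integrable_gibbs_iff.1 (memLp_one_iff_integrable.1 (hG.smul hψ.memLp_fun)))
    (by simpa only [smul_eq_mul, mul_assoc] using!
      hW.integrable_gibbs_iff.1 (hg.integrable_mul hψ.memLp_fun))
  simpa only [hW.integral_gibbs, real_inner_smul_left, smul_eq_mul, mul_assoc] using h_test

end Testing

/-! ### The Poisson equation -/

lemma exists_isOn_ae_eq {α : Type} (D : Dom) (h : Sp d → α) :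
    ∃ h' : Sp d → α, IsOn D h' ∧ h' =ᵐ[vol D d] h := by
  cases D with
  | line => exact ⟨h, trivial, .rfl⟩
  | torus =>
    choose l hl hl_unique using existsUnique_add_mem_cell (d := d)
    refine ⟨fun x => h (l x + x), isOn_torus_iff.2 fun k hk x => congrArg h ?_, ?_⟩
    · have h_eq : l (k + x) + ⟨k, hk⟩ = l x := hl_unique x _ (by
        simpa only [Submodule.coe_add, add_assoc] using hl (k + x))
      rw [← h_eq, Submodule.coe_add, add_assoc]
    · rw [vol_torus]
      filter_upwards [ae_restrict_mem measurableSet_cell] with x hx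
      rw [← hl_unique x 0 (by simpa only [Submodule.coe_zero, zero_add] using hx),
        Submodule.coe_zero, zero_add]

lemma mem_orthogonal_span_iff {𝕜 E : Type*} [RCLike 𝕜] [NormedAddCommGroup E]
    [InnerProductSpace 𝕜 E] {s : Set E} {v : E} :
    v ∈ (Submodule.span 𝕜 s)ᗮ ↔ ∀ u ∈ s, inner 𝕜 u v = 0 := by
  have h_iff : v ∈ (Submodule.span 𝕜 s)ᗮ ↔ Submodule.span 𝕜 s ≤ (𝕜 ∙ v)ᗮ := by
    rw [Submodule.mem_orthogonal]
    exact forall₂_congr fun u _ => Submodule.mem_orthogonal_singleton_iff_inner_left.symm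
  rw [h_iff, Submodule.span_le]
  exact forall₂_congr fun u _ => Submodule.mem_orthogonal_singleton_iff_inner_left

section PairL2

variable {X E : Type*} [MeasurableSpace X] {m : Measure X} [NormedAddCommGroup E]
  {φ ψ : X → ℝ} {G H : X → E}

/-- The element `(φ, G)` of the Hilbert sum `L²(m) ⊕ L²(m; E)`, in which Sobolev functions are
paired with their weak gradients. -/
def pairL2 (hφ : MemLp φ 2 m) (hG : MemLp G 2 m) : WithLp 2 (Lp ℝ 2 m × Lp E 2 m) :=
  WithLp.toLp 2 (hφ.toLp φ, hG.toLp G)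

lemma pairL2_coe (p : WithLp 2 (Lp ℝ 2 m × Lp E 2 m)) :
    pairL2 (Lp.memLp p.fst) (Lp.memLp p.snd) = p := by
  simp only [pairL2, Lp.toLp_coeFn]
  rfl

variable [InnerProductSpace ℝ E]

lemma inner_toLp (hG : MemLp G 2 m) (hH : MemLp H 2 m) :
    inner ℝ (hG.toLp G) (hH.toLp H) = ∫ x, inner ℝ (G x) (H x) ∂m := by
  rw [L2.inner_def]
  refine integral_congr_ae ?_
  filter_upwards [hG.coeFn_toLp, hH.coeFn_toLp] with x hGx hHx
  rw [hGx, hHx]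

lemma inner_pairL2 (hφ : MemLp φ 2 m) (hG : MemLp G 2 m) (hψ : MemLp ψ 2 m) (hH : MemLp H 2 m) :
    inner ℝ (pairL2 hφ hG) (pairL2 hψ hH) =
      (∫ x, φ x * ψ x ∂m) + ∫ x, inner ℝ (G x) (H x) ∂m := by
  rw [WithLp.prod_inner_apply]
  simp only [pairL2, inner_toLp, RCLike.inner_apply', conj_trivial]

end PairL2

section Sobolev

variable {D : Dom} {W : Sp d → ℝ}

lemma exists_memH1_ae_eq (hW : IsPotential D W) {φ : Sp d → ℝ} {G : Sp d → Sp d}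
    (hφ : MemLp φ 2 (gibbs D W)) (hG : MemLp G 2 (gibbs D W))
    (h_parts : ∀ ξ : Sp d → ℝ, IsTest D ξ → ∀ i : Fin d,
      ∫ x, φ x * (gradient ξ x) i ∂(vol D d) = -∫ x, G x i * ξ x ∂(vol D d)) :
    ∃ φ' G', MemH1 D (gibbs D W) φ' G' ∧ φ' =ᵐ[gibbs D W] φ ∧ G' =ᵐ[gibbs D W] G := by
  obtain ⟨φ', hφ'_on, hφ'⟩ := exists_isOn_ae_eq D φ
  obtain ⟨G', hG'_on, hG'⟩ := exists_isOn_ae_eq D G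
  have h_ac := gibbs_absolutelyContinuous D W
  have hφ'_L2 := hφ.ae_eq (h_ac.ae_eq hφ').symm
  have hG'_L2 := hG.ae_eq (h_ac.ae_eq hG').symm
  refine ⟨φ', G', ⟨⟨hφ'_on, hG'_on, (hW.locallyL2_vol hφ'_L2).locallyIntegrable,
    (hW.locallyL2_vol hG'_L2).locallyIntegrable, fun ξ hξ i => ?_⟩, hφ'_L2, hG'_L2⟩,
    h_ac.ae_eq hφ', h_ac.ae_eq hG'⟩
  rw [integral_congr_ae (hφ'.mono fun x hx => congrArg (· * gradient ξ x i) hx), h_parts ξ hξ i,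
    integral_congr_ae (hG'.mono fun x hx => congrArg (fun v : Sp d => v i * ξ x) hx)]

lemma IsCc.memLp_inv_density_mul {q : Sp d → ℝ} (hq : IsCc D q) (hW : IsPotential D W) :
    MemLp (fun x => (gibbsDensity D W x)⁻¹ * q x) 2 (gibbs D W) := by
  simpa only [mul_comm] using!
    (hq.mul_right hW.continuous_inv_density (hW.isOn_density.comp (·⁻¹))).memLp_gibbs hW 2

lemma memLp_single (hW : IsPotential D W) {ξ : Sp d → ℝ} (hξ : IsTest D ξ) (i : Fin d) :
    MemLp (fun x => EuclideanSpace.single i ((gibbsDensity D W x)⁻¹ * ξ x)) 2 (gibbs D W) :=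
  .of_eval_piLp fun j => by
    simp only [PiLp.single_apply]
    by_cases h : j = i
    · simpa only [h, if_true] using hξ.isCc.memLp_inv_density_mul hW
    · simpa only [h, if_false] using MemLp.zero'

lemma IsPotential.integral_vol (hW : IsPotential D W) (h : Sp d → ℝ) :
    ∫ x, h x ∂(vol D d) = ∫ x, (gibbsDensity D W x)⁻¹ * h x ∂(gibbs D W) := by
  simp only [hW.integral_gibbs, smul_eq_mul, mul_inv_cancel_left₀ (hW.density_pos _).ne']

/-- The vector to which `(φ, G)` is orthogonal if and only if integration by parts in the
direction `i` holds against the test function `ξ`. -/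
def partsVector (hW : IsPotential D W) {ξ : Sp d → ℝ} (hξ : IsTest D ξ) (i : Fin d) :
    WithLp 2 (Lp ℝ 2 (gibbs D W) × Lp (Sp d) 2 (gibbs D W)) :=
  pairL2 ((hξ.gradient_apply i).isCc.memLp_inv_density_mul hW) (memLp_single hW hξ i)

lemma inner_partsVector (hW : IsPotential D W) {ξ : Sp d → ℝ} (hξ : IsTest D ξ) (i : Fin d)
    {φ : Sp d → ℝ} {G : Sp d → Sp d} (hφ : MemLp φ 2 (gibbs D W)) (hG : MemLp G 2 (gibbs D W)) :
    inner ℝ (partsVector hW hξ i) (pairL2 hφ hG) =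
      (∫ x, φ x * gradient ξ x i ∂(vol D d)) + ∫ x, G x i * ξ x ∂(vol D d) := by
  rw [partsVector, inner_pairL2, hW.integral_vol, hW.integral_vol]
  simp only [EuclideanSpace.inner_single_left, conj_trivial]
  congr 1 <;> exact integral_congr_ae (.of_forall fun x => by ring)

/-- The space `H¹ ∩ L²₀` of Sobolev functions of mean zero, as a closed subspace of
`L² ⊕ L²(·; ℝ^d)`. -/
def meanZeroH1 (hW : IsPotential D W) :
    Submodule ℝ (WithLp 2 (Lp ℝ 2 (gibbs D W) × Lp (Sp d) 2 (gibbs D W))) :=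
  have := hW.isProbabilityMeasure
  (Submodule.span ℝ (insert (pairL2 (memLp_const 1) (memLp_const 0))
    {v | ∃ (ξ : Sp d → ℝ) (hξ : IsTest D ξ) (i : Fin d), v = partsVector hW hξ i}))ᗮ

lemma pairL2_mem_meanZeroH1 (hW : IsPotential D W) {φ : Sp d → ℝ} {G : Sp d → Sp d}
    (hφ : MemLp φ 2 (gibbs D W)) (hG : MemLp G 2 (gibbs D W)) :
    pairL2 hφ hG ∈ meanZeroH1 hW ↔ ∫ x, φ x ∂(gibbs D W) = 0 ∧
      ∀ ξ : Sp d → ℝ, IsTest D ξ → ∀ i : Fin d,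
        ∫ x, φ x * gradient ξ x i ∂(vol D d) = -∫ x, G x i * ξ x ∂(vol D d) := by
  have := hW.isProbabilityMeasure
  rw [meanZeroH1, mem_orthogonal_span_iff, Set.forall_mem_insert, inner_pairL2]
  simp only [one_mul, inner_zero_left, integral_zero, add_zero, ← add_eq_zero_iff_eq_neg]
  refine and_congr_right fun _ => ⟨fun h ξ hξ i => ?_, ?_⟩
  · rw [← inner_partsVector hW hξ i hφ hG]
    exact h _ ⟨ξ, hξ, i, rfl⟩
  · rintro h _ ⟨ξ, hξ, i, rfl⟩
    rw [inner_partsVector hW hξ i hφ hG, h ξ hξ i]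

lemma exists_memH1_pairL2_eq (hW : IsPotential D W)
    {p : WithLp 2 (Lp ℝ 2 (gibbs D W) × Lp (Sp d) 2 (gibbs D W))} (hp : p ∈ meanZeroH1 hW) :
    ∃ (φ : Sp d → ℝ) (G : Sp d → Sp d) (h : MemH1 D (gibbs D W) φ G),
      ∫ x, φ x ∂(gibbs D W) = 0 ∧ pairL2 h.memLp_fun h.memLp_grad = p := by
  obtain ⟨h_mean, h_parts⟩ := (pairL2_mem_meanZeroH1 hW (Lp.memLp p.fst) (Lp.memLp p.snd)).1
    ((pairL2_coe p).symm ▸ hp)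
  obtain ⟨φ, G, h, hφ, hG⟩ := exists_memH1_ae_eq hW (Lp.memLp p.fst) (Lp.memLp p.snd) h_parts
  refine ⟨φ, G, h, (integral_congr_ae hφ).trans h_mean, ?_⟩
  rw [← pairL2_coe p, pairL2, pairL2, (MemLp.toLp_eq_toLp_iff ..).2 hφ,
    (MemLp.toLp_eq_toLp_iff ..).2 hG]

lemma Poincare.exists_norm_sq_le (hP : Poincare D (gibbs D W)) (hW : IsPotential D W) :
    ∃ c > 0, ∀ p ∈ meanZeroH1 hW, c * ‖p‖ ^ 2 ≤ ‖p.snd‖ ^ 2 := by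
  obtain ⟨R, hR, hP⟩ := hP
  refine ⟨(1 / R + 1)⁻¹, by positivity, fun p hp => ?_⟩
  obtain ⟨φ, G, h, h_mean, rfl⟩ := exists_memH1_pairL2_eq hW hp
  have h_poincare := hP φ G h h_mean
  have h_fst : ‖h.memLp_fun.toLp φ‖ ^ 2 = ∫ x, φ x ^ 2 ∂(gibbs D W) := by
    rw [← real_inner_self_eq_norm_sq, inner_toLp]
    simp only [real_inner_self_eq_norm_sq, Real.norm_eq_abs, sq_abs]
  have h_snd : ‖h.memLp_grad.toLp G‖ ^ 2 = ∫ x, ‖G x‖ ^ 2 ∂(gibbs D W) := by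
    rw [← real_inner_self_eq_norm_sq, inner_toLp]
    simp only [real_inner_self_eq_norm_sq]
  rw [inv_mul_le_iff₀ (by positivity), WithLp.prod_norm_sq_eq_of_L2]
  change ‖h.memLp_fun.toLp φ‖ ^ 2 + ‖h.memLp_grad.toLp G‖ ^ 2 ≤
    (1 / R + 1) * ‖h.memLp_grad.toLp G‖ ^ 2
  rw [h_fst, h_snd]
  linarith

lemma exists_inner_map_eq {X Y : Type*} [NormedAddCommGroup X] [InnerProductSpace ℝ X]
    [CompleteSpace X] [NormedAddCommGroup Y] [InnerProductSpace ℝ Y] (T : X →L[ℝ] Y) {c : ℝ}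
    (hc : 0 < c) (hT : ∀ v, c * ‖v‖ ^ 2 ≤ ‖T v‖ ^ 2) (q : X) :
    ∃ u, ∀ w, inner ℝ (T u) (T w) = inner ℝ q w := by
  let B : X →L[ℝ] X →L[ℝ] ℝ := (innerSL ℝ).bilinearComp T T
  have hB (u w : X) : B u w = inner ℝ (T u) (T w) := rfl
  have h_coercive : IsCoercive B := by
    refine ⟨c, hc, fun u => ?_⟩
    rw [hB, real_inner_self_eq_norm_sq, mul_assoc, ← sq]
    exact hT u
  refine ⟨h_coercive.continuousLinearEquivOfBilin.symm q, fun w => ?_⟩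
  rw [← hB, ← h_coercive.continuousLinearEquivOfBilin_apply,
    ContinuousLinearEquiv.apply_symm_apply]

theorem exists_memH1_integral_inner_eq (hW : IsPotential D W) (hP : Poincare D (gibbs D W))
    {g : Sp d → ℝ} (hg : MemLp g 2 (gibbs D W)) (hg_mean : ∫ x, g x ∂(gibbs D W) = 0) :
    ∃ φ G, MemH1 D (gibbs D W) φ G ∧ ∫ x, φ x ∂(gibbs D W) = 0 ∧
      ∀ ψ H, MemH1 D (gibbs D W) ψ H →
        ∫ x, inner ℝ (G x) (H x) ∂(gibbs D W) = ∫ x, g x * ψ x ∂(gibbs D W) := by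
  have := hW.isProbabilityMeasure
  obtain ⟨c, hc, h_coercive⟩ := hP.exists_norm_sq_le hW
  have : CompleteSpace (meanZeroH1 hW) := Submodule.instOrthogonalCompleteSpace _
  obtain ⟨u, hu⟩ := exists_inner_map_eq
    ((WithLp.sndL 2 ℝ _ _).comp (meanZeroH1 hW).subtypeL) hc (fun p => h_coercive p p.2)
    ((meanZeroH1 hW).orthogonalProjectionOnto (pairL2 hg (memLp_const 0)))
  obtain ⟨φ, G, h, h_mean, hu_eq⟩ := exists_memH1_pairL2_eq hW u.2
  have h_test {ψ : Sp d → ℝ} {H : Sp d → Sp d} (hψ : MemH1 D (gibbs D W) ψ H)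
      (hψ_mean : ∫ x, ψ x ∂(gibbs D W) = 0) :
      ∫ x, inner ℝ (G x) (H x) ∂(gibbs D W) = ∫ x, g x * ψ x ∂(gibbs D W) := by
    have h_eq := hu ⟨pairL2 hψ.memLp_fun hψ.memLp_grad,
      (pairL2_mem_meanZeroH1 hW _ _).2 ⟨hψ_mean, hψ.weakGrad.parts⟩⟩
    rw [Submodule.inner_orthogonalProjectionOnto_eq_of_mem_right, inner_pairL2] at h_eq
    simp only [inner_zero_left, integral_zero, add_zero] at h_eq
    rw [← h_eq, ← inner_toLp h.memLp_grad hψ.memLp_grad]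
    exact congrArg (fun p => inner ℝ p.snd _) hu_eq
  refine ⟨φ, G, h, h_mean, fun ψ H hψ => ?_⟩
  have hψ_int := hψ.memLp_fun.integrable one_le_two
  have hg_int := hg.integrable one_le_two
  have hgψ_int : Integrable (fun x => g x * ψ x) (gibbs D W) := hg.integrable_mul hψ.memLp_fun
  rw [h_test (hψ.sub_const (∫ x, ψ x ∂(gibbs D W)))
    (by simp [integral_sub hψ_int (integrable_const _)])]
  simp only [mul_sub]
  rw [integral_sub hgψ_int (hg_int.mul_const _), integral_mul_const,
    hg_mean, zero_mul, sub_zero]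

lemma Poincare.ae_eq_zero (hP : Poincare D (gibbs D W)) {φ : Sp d → ℝ} {G : Sp d → Sp d}
    (h : MemH1 D (gibbs D W) φ G) (h_mean : ∫ x, φ x ∂(gibbs D W) = 0)
    (h_energy : ∫ x, ‖G x‖ ^ 2 ∂(gibbs D W) = 0) :
    φ =ᵐ[gibbs D W] 0 ∧ G =ᵐ[gibbs D W] 0 := by
  obtain ⟨R, -, hP⟩ := hP
  have h_sq : ∫ x, φ x ^ 2 ∂(gibbs D W) = 0 := le_antisymm
    ((hP φ G h h_mean).trans_eq (by rw [h_energy, mul_zero])) (integral_nonneg fun _ => sq_nonneg _)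
  rw [integral_eq_zero_iff_of_nonneg (fun _ => sq_nonneg _) h.memLp_fun.integrable_sq] at h_sq
  rw [integral_eq_zero_iff_of_nonneg (fun _ => sq_nonneg _)
    (h.memLp_grad.integrable_norm_pow two_ne_zero)] at h_energy
  exact ⟨h_sq.mono fun x hx => by simpa using hx, h_energy.mono fun x hx => by simpa using hx⟩

end Sobolev

/-- A bounded continuous function on `𝔻^d`, the class of perturbations of a potential. -/
structure IsBddCont (D : Dom) (w : Sp d → ℝ) : Prop where
  isOn : IsOn D w
  continuous : Continuous w
  bounded : ∃ C, ∀ x, ‖w x‖ ≤ C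

lemma IsTest.isBddCont {D : Dom} {ξ : Sp d → ℝ} (hξ : IsTest D ξ) : IsBddCont D ξ :=
  ⟨hξ.smooth.isOn, hξ.smooth.contDiff.continuous, hξ.isCc.exists_bound⟩

namespace IsBddCont

variable {D : Dom} {w : Sp d → ℝ}

lemma comp (hw : IsBddCont D w) {k : ℝ → ℝ} (hk : Continuous k) : IsBddCont D fun x => k (w x) := by
  obtain ⟨C, hC⟩ := hw.bounded
  obtain ⟨C', hC'⟩ := (isCompact_closedBall 0 C).exists_bound_of_continuousOn hk.continuousOn
  exact ⟨hw.isOn.comp k, hk.comp hw.continuous,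
    C', fun x => hC' _ (mem_closedBall_zero_iff.2 (hC x))⟩

lemma neg (hw : IsBddCont D w) : IsBddCont D (-w) := hw.comp continuous_neg

lemma const_smul (hw : IsBddCont D w) (c : ℝ) : IsBddCont D (c • w) :=
  hw.comp (continuous_const_mul c)

lemma memLp_top (hw : IsBddCont D w) (m : Measure (Sp d)) : MemLp w ⊤ m := by
  obtain ⟨C, hC⟩ := hw.bounded
  exact memLp_top_of_bound hw.continuous.aestronglyMeasurable C (.of_forall hC)

end IsBddCont

section Perturbation

variable {D : Dom} {W w : Sp d → ℝ}

lemma IsPotential.add (hW : IsPotential D W) (hw : IsBddCont D w) : IsPotential D (W + w) where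
  isOn := hW.isOn.comp₂ hw.isOn (· + ·)
  continuous := hW.continuous.add hw.continuous
  integrable_exp := by
    obtain ⟨-, h_cont, C, hC⟩ := hw.comp (Real.continuous_exp.comp continuous_neg)
    simp only [Pi.add_apply, neg_add, Real.exp_add]
    exact hW.integrable_exp.mul_bdd h_cont.aestronglyMeasurable (.of_forall hC)

lemma Zc_add_mul_integral_gibbs (hW : IsPotential D W) (hWw : IsPotential D (W + w))
    (h : Sp d → ℝ) : Zc D (W + w) * ∫ x, h x ∂(gibbs D (W + w)) =
      Zc D W * ∫ x, Real.exp (-w x) * h x ∂(gibbs D W) := by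
  simp only [hW.Zc_mul_integral_gibbs, hWw.Zc_mul_integral_gibbs, Pi.add_apply, neg_add,
    Real.exp_add, mul_assoc]

lemma Zc_add (hW : IsPotential D W) (hWw : IsPotential D (W + w)) :
    Zc D (W + w) = Zc D W * ∫ x, Real.exp (-w x) ∂(gibbs D W) := by
  have := hWw.isProbabilityMeasure
  simpa using Zc_add_mul_integral_gibbs hW hWw fun _ => 1

lemma exists_gibbs_add_le_smul (hW : IsPotential D W) (hw : IsBddCont D w) :
    ∃ K : ℝ≥0, 0 < K ∧ gibbs D (W + w) ≤ (K : ENNReal) • gibbs D W := by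
  have hZ := hW.Zc_pos
  have hZ' := (hW.add hw).Zc_pos
  obtain ⟨C, hC⟩ := hw.bounded
  have hK : 0 < Real.exp C * Zc D W / Zc D (W + w) := by positivity
  refine ⟨.mk _ hK.le, hK, ?_⟩
  rw [gibbs_eq_withDensity, gibbs_eq_withDensity, ← withDensity_smul _ hW.measurable_ofReal_density]
  refine withDensity_mono (.of_forall fun x => ?_)
  rw [Pi.smul_apply, smul_eq_mul, ← ENNReal.ofReal_eq_coe_nnreal, ← ENNReal.ofReal_mul hK.le]
  refine ENNReal.ofReal_le_ofReal ?_
  calc gibbsDensity D (W + w) x = Real.exp (-w x) * Real.exp (-W x) / Zc D (W + w) := by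
        rw [gibbsDensity, Pi.add_apply, neg_add_rev, Real.exp_add]
    _ ≤ Real.exp C * Real.exp (-W x) / Zc D (W + w) := by
        gcongr
        exact (neg_le_abs _).trans (hC x)
    _ = Real.exp C * Zc D W / Zc D (W + w) * gibbsDensity D W x := by
        rw [gibbsDensity]
        field_simp

lemma exists_gibbs_le_smul_add (hW : IsPotential D W) (hw : IsBddCont D w) :
    ∃ K : ℝ≥0, 0 < K ∧ gibbs D W ≤ (K : ENNReal) • gibbs D (W + w) := by
  simpa only [add_neg_cancel_right] using exists_gibbs_add_le_smul (hW.add hw) hw.neg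

lemma integral_le_of_le_smul {X : Type*} [MeasurableSpace X] {m m' : Measure X} {K : ℝ≥0}
    (h_le : m' ≤ (K : ENNReal) • m) {h : X → ℝ} (h_nonneg : 0 ≤ h) (h_int : Integrable h m) :
    ∫ x, h x ∂m' ≤ K * ∫ x, h x ∂m :=
  (integral_mono_measure h_le (.of_forall h_nonneg)
    (h_int.smul_measure ENNReal.coe_ne_top)).trans_eq
    (by rw [integral_smul_measure, ENNReal.coe_toReal, smul_eq_mul])

lemma integral_sq_le_integral_sub_const_sq {X : Type*} [MeasurableSpace X] {m : Measure X}
    [IsProbabilityMeasure m] {φ : X → ℝ} (hφ : AEStronglyMeasurable φ m)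
    (h_mean : ∫ x, φ x ∂m = 0) (c : ℝ) : ∫ x, φ x ^ 2 ∂m ≤ ∫ x, (φ x - c) ^ 2 ∂m := by
  rw [← variance_of_integral_eq_zero hφ.aemeasurable h_mean, ← variance_sub_const hφ c]
  exact variance_le_expectation_sq (hφ.sub aestronglyMeasurable_const)

lemma MemH1.of_le_smul {m m' : Measure (Sp d)} {K : ℝ≥0} (h_le : m' ≤ (K : ENNReal) • m)
    {φ : Sp d → ℝ} {G : Sp d → Sp d} (h : MemH1 D m φ G) : MemH1 D m' φ G where
  weakGrad := h.weakGrad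
  memLp_fun := h.memLp_fun.of_measure_le_smul ENNReal.coe_ne_top h_le
  memLp_grad := h.memLp_grad.of_measure_le_smul ENNReal.coe_ne_top h_le

lemma memH1_gibbs_add_iff (hW : IsPotential D W) (hw : IsBddCont D w) {φ : Sp d → ℝ}
    {G : Sp d → Sp d} : MemH1 D (gibbs D (W + w)) φ G ↔ MemH1 D (gibbs D W) φ G := by
  obtain ⟨K, -, hK⟩ := exists_gibbs_add_le_smul hW hw
  obtain ⟨K', -, hK'⟩ := exists_gibbs_le_smul_add hW hw
  exact ⟨fun h => h.of_le_smul hK', fun h => h.of_le_smul hK⟩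

lemma Poincare.of_le_smul {m m' : Measure (Sp d)} [IsProbabilityMeasure m]
    [IsProbabilityMeasure m'] {K K' : ℝ≥0} (hK : 0 < K) (hK' : 0 < K')
    (h_le : m' ≤ (K : ENNReal) • m) (h_le' : m ≤ (K' : ENNReal) • m') (hP : Poincare D m) :
    Poincare D m' := by
  obtain ⟨R, hR, hP⟩ := hP
  refine ⟨R / (K * K'), by positivity, fun φ G h h_mean => ?_⟩
  have hφ_int := (h.of_le_smul h_le').memLp_fun.integrable one_le_two
  let c := ∫ x, φ x ∂m
  have h_centred : MemH1 D m (fun x => φ x - c) G := (h.of_le_smul h_le').sub_const c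
  have h_centred_mean : ∫ x, φ x - c ∂m = 0 := by
    rw [integral_sub hφ_int (integrable_const c), integral_const, probReal_univ, one_smul,
      sub_self]
  calc ∫ x, φ x ^ 2 ∂m' ≤ ∫ x, (φ x - c) ^ 2 ∂m' :=
        integral_sq_le_integral_sub_const_sq h.memLp_fun.1 h_mean c
    _ ≤ K * ∫ x, (φ x - c) ^ 2 ∂m :=
        integral_le_of_le_smul h_le (fun _ => sq_nonneg _) h_centred.memLp_fun.integrable_sq
    _ ≤ K * (1 / R * ∫ x, ‖G x‖ ^ 2 ∂m) := by
        gcongr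
        exact hP _ G h_centred h_centred_mean
    _ ≤ K * (1 / R * (K' * ∫ x, ‖G x‖ ^ 2 ∂m')) := by
        gcongr
        exact integral_le_of_le_smul h_le' (fun _ => sq_nonneg _)
          (h.memLp_grad.integrable_norm_pow two_ne_zero)
    _ = 1 / (R / (K * K')) * ∫ x, ‖G x‖ ^ 2 ∂m' := by field_simp

/-- The Holley–Stroock perturbation principle. -/
lemma Poincare.gibbs_add (hP : Poincare D (gibbs D W)) (hW : IsPotential D W)
    (hw : IsBddCont D w) : Poincare D (gibbs D (W + w)) := by
  obtain ⟨K, hK, h_le⟩ := exists_gibbs_add_le_smul hW hw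
  obtain ⟨K', hK', h_le'⟩ := exists_gibbs_le_smul_add hW hw
  have := hW.isProbabilityMeasure
  have := (hW.add hw).isProbabilityMeasure
  exact hP.of_le_smul hK hK' h_le h_le'

end Perturbation

/-- What the theory of the Poisson equation needs of the potential `V`, of the observable `f` and
of the bias `U`. -/
structure PoissonData (D : Dom) (V f U : Sp d → ℝ) : Prop where
  potential : IsPotential D V
  biased : IsPotential D (V + U)
  isOn_obs : IsOn D f
  integrable_obs : Integrable f (gibbs D V)
  poincare : Poincare D (gibbs D (V + U))
  memLp_source : MemLp (fun x => (f x - mean D V f) * Real.exp (U x)) 2 (gibbs D (V + U))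

lemma Admissible.poissonData {D : Dom} {V f U : Sp d → ℝ} (hU : Admissible D V f U)
    (hVf : Standing D V f) : PoissonData D V f U where
  potential := ⟨hVf.smooth_pot.isOn, hVf.smooth_pot.contDiff.continuous, hVf.integrable_exp⟩
  biased := ⟨hVf.smooth_pot.isOn.comp₂ hU.smooth.isOn (· + ·),
    hVf.smooth_pot.contDiff.continuous.add hU.smooth.contDiff.continuous, hU.integrable_exp⟩
  isOn_obs := hVf.smooth_obs.isOn
  integrable_obs := hVf.integrable_obs
  poincare := hU.poincare
  memLp_source := hU.memLp

namespace PoissonData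

variable {D : Dom} {V f U : Sp d → ℝ}

lemma isOn_source (h : PoissonData D V f U) :
    IsOn D fun x => (f x - mean D V f) * Real.exp (U x) := by
  have hU : IsOn D U := by
    simpa only [Pi.add_apply, add_sub_cancel_left] using!
      h.biased.isOn.comp₂ h.potential.isOn (· - ·)
  exact h.isOn_obs.comp₂ hU fun a b => (a - mean D V f) * Real.exp b

/-- The weight `e^U` in the source cancels the bias, so that the right-hand side of the weak
Poisson equation, once unnormalized, is independent of `U`. -/
lemma Zc_mul_integral_source (h : PoissonData D V f U) (ψ : Sp d → ℝ) :
    Zc D (V + U) * ∫ x, (f x - mean D V f) * Real.exp (U x) * ψ x ∂(gibbs D (V + U)) =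
      Zc D V * ∫ x, (f x - mean D V f) * ψ x ∂(gibbs D V) := by
  rw [Zc_add_mul_integral_gibbs h.potential h.biased]
  congr! 3 with x
  rw [mul_comm (f x - _), mul_assoc, ← mul_assoc, ← Real.exp_add, neg_add_cancel, Real.exp_zero,
    one_mul]

lemma integral_source (h : PoissonData D V f U) :
    ∫ x, (f x - mean D V f) * Real.exp (U x) ∂(gibbs D (V + U)) = 0 := by
  have := h.potential.isProbabilityMeasure
  have h_mean : ∫ x, f x - mean D V f ∂(gibbs D V) = 0 := by
    simp [integral_sub h.integrable_obs (integrable_const _), mean]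
  simpa [h_mean, h.biased.Zc_pos.ne'] using h.Zc_mul_integral_source fun _ => 1

lemma perturb (h : PoissonData D V f U) {w : Sp d → ℝ} (hw : IsBddCont D w) :
    PoissonData D V f (U + w) where
  potential := h.potential
  biased := add_assoc V U w ▸ h.biased.add hw
  isOn_obs := h.isOn_obs
  integrable_obs := h.integrable_obs
  poincare := add_assoc V U w ▸ h.poincare.gibbs_add h.biased hw
  memLp_source := by
    obtain ⟨K, -, hK⟩ := exists_gibbs_add_le_smul h.biased hw
    rw [← add_assoc]
    refine .of_measure_le_smul ENNReal.coe_ne_top hK ?_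
    simp only [Pi.add_apply, Real.exp_add, ← mul_assoc]
    exact ((hw.comp Real.continuous_exp).memLp_top _).mul h.memLp_source

end PoissonData

section PoissonEquation

variable {D : Dom} {V f U : Sp d → ℝ} {φ φ' ψ : Sp d → ℝ} {G G' H : Sp d → Sp d}

lemma IsPoissonSol.integral_inner_eq (hφ : IsPoissonSol D V f U φ G) (h : PoissonData D V f U)
    (hψ : MemH1 D (gibbs D (V + U)) ψ H) :
    ∫ x, inner ℝ (G x) (H x) ∂(gibbs D (V + U)) =
      ∫ x, (f x - mean D V f) * Real.exp (U x) * ψ x ∂(gibbs D (V + U)) :=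
  hψ.integral_inner_eq h.biased hφ.memH1.weakGrad.isOn_grad hφ.memH1.memLp_grad h.isOn_source
    h.memLp_source hφ.eq

lemma IsPoissonSol.ae_eq (hφ : IsPoissonSol D V f U φ G) (hφ' : IsPoissonSol D V f U φ' G')
    (h : PoissonData D V f U) : φ' =ᵐ[vol D d] φ ∧ G' =ᵐ[vol D d] G := by
  have := h.biased.isProbabilityMeasure
  have h_sub := hφ'.memH1.sub hφ.memH1
  have h_mean : ∫ x, φ' x - φ x ∂(gibbs D (V + U)) = 0 := by
    rw [integral_sub (hφ'.memH1.memLp_fun.integrable one_le_two)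
      (hφ.memH1.memLp_fun.integrable one_le_two), hφ'.mean_zero, hφ.mean_zero, sub_zero]
  have h_energy : ∫ x, ‖G' x - G x‖ ^ 2 ∂(gibbs D (V + U)) = 0 := by
    simp only [← real_inner_self_eq_norm_sq, inner_sub_left (𝕜 := ℝ) (G' _) (G _)]
    rw [integral_sub (integrable_inner_of_memLp hφ'.memH1.memLp_grad h_sub.memLp_grad)
      (integrable_inner_of_memLp hφ.memH1.memLp_grad h_sub.memLp_grad),
      hφ'.integral_inner_eq h h_sub, hφ.integral_inner_eq h h_sub, sub_self]
  obtain ⟨h_fun, h_grad⟩ := h.poincare.ae_eq_zero h_sub h_mean h_energy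
  have h_ac := h.biased.vol_absolutelyContinuous
  exact ⟨(h_ac.ae_eq h_fun).mono fun x hx => sub_eq_zero.1 hx,
    (h_ac.ae_eq h_grad).mono fun x hx => sub_eq_zero.1 hx⟩

theorem PoissonData.poissonWellPosed (h : PoissonData D V f U) : PoissonWellPosed D V f U := by
  obtain ⟨φ, G, hφ, h_mean, h_eq⟩ :=
    exists_memH1_integral_inner_eq h.biased h.poincare h.memLp_source h.integral_source
  have h_sol : IsPoissonSol D V f U φ G :=
    ⟨hφ, h_mean, fun ξ hξ => h_eq ξ _ (hξ.memH1 h.biased)⟩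
  exact ⟨φ, G, h_sol, fun _ _ hφ' => h_sol.ae_eq hφ' h⟩

lemma IsPoissonSol.integral_exp_mul_inner (hφ : IsPoissonSol D V f U φ G)
    (h : PoissonData D V f U) {w : Sp d → ℝ} (hw : IsBddCont D w)
    (hφ' : IsPoissonSol D V f (U + w) φ' G') (hψ : MemH1 D (gibbs D (V + U)) ψ H) :
    ∫ x, Real.exp (-w x) * inner ℝ (G' x) (H x) ∂(gibbs D (V + U)) =
      ∫ x, inner ℝ (G x) (H x) ∂(gibbs D (V + U)) := by
  have hψ' : MemH1 D (gibbs D (V + (U + w))) ψ H :=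
    add_assoc V U w ▸ (memH1_gibbs_add_iff h.biased hw).2 hψ
  refine mul_left_cancel₀ h.biased.Zc_pos.ne' ?_
  rw [← Zc_add_mul_integral_gibbs h.biased (h.biased.add hw), add_assoc,
    hφ'.integral_inner_eq (h.perturb hw) hψ', hφ.integral_inner_eq h hψ,
    (h.perturb hw).Zc_mul_integral_source, h.Zc_mul_integral_source]

end PoissonEquation

/-! ### Differentiation of the energy -/

section Energy

variable {X E : Type*} [MeasurableSpace X] {m : Measure X} [NormedAddCommGroup E]
  [InnerProductSpace ℝ E] {δ w : X → ℝ}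

lemma exists_ae_norm_le_of_memLp_top (hw : MemLp w ⊤ m) : ∃ C, ∀ᵐ x ∂m, ‖w x‖ ≤ C := by
  obtain ⟨-, h_top⟩ := hw
  rw [eLpNorm_exponent_top, eLpNormEssSup_lt_top_iff_isBoundedUnder] at h_top
  obtain ⟨C, hC⟩ := h_top
  exact ⟨C, eventually_map.1 hC⟩

lemma memLp_top_exp (hw : MemLp w ⊤ m) : MemLp (fun x => Real.exp (w x)) ⊤ m := by
  obtain ⟨C, hC⟩ := exists_ae_norm_le_of_memLp_top hw
  refine memLp_top_of_bound (Real.continuous_exp.comp_aestronglyMeasurable hw.1) (Real.exp C) ?_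
  filter_upwards [hC] with x hx
  rw [Real.norm_eq_abs, Real.abs_exp]
  exact Real.exp_le_exp.2 ((le_abs_self _).trans hx)

lemma hasDerivAt_integral_exp_mul (hδ : MemLp δ ⊤ m) {q : X → ℝ} (hq : Integrable q m) :
    HasDerivAt (fun ε : ℝ => ∫ x, Real.exp (ε * δ x) * q x ∂m) (∫ x, δ x * q x ∂m) 0 := by
  obtain ⟨C, hC⟩ := exists_ae_norm_le_of_memLp_top hδ
  have h_deriv := hasDerivAt_integral_of_dominated_loc_of_deriv_le (x₀ := (0 : ℝ)) (μ := m)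
    (F := fun ε x => Real.exp (ε * δ x) * q x) (F' := fun ε x => Real.exp (ε * δ x) * δ x * q x)
    (bound := fun x => Real.exp C * C * ‖q x‖) (Metric.ball_mem_nhds 0 one_pos)
    (.of_forall fun ε => (Real.continuous_exp.comp_aestronglyMeasurable
      (hδ.1.const_mul ε)).mul hq.1) (by simpa using hq)
    (by simpa using! hδ.1.mul hq.1) ?_ (hq.norm.const_mul _) ?_
  · simpa using h_deriv.2
  · filter_upwards [hC] with x hx ε hε
    have hεδ : ε * δ x ≤ C := (le_abs_self _).trans <| by
      rw [abs_mul]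
      exact (mul_le_of_le_one_left (abs_nonneg _) (mem_ball_zero_iff.1 hε).le).trans hx
    rw [norm_mul, norm_mul, Real.norm_eq_abs (Real.exp _), Real.abs_exp]
    gcongr
  · exact .of_forall fun x ε _ => by
      simpa using (((hasDerivAt_id ε).mul_const (δ x)).exp).mul_const (q x)

lemma hasDerivAt_of_le_of_le {l g u : ℝ → ℝ} {x L : ℝ} (hl : HasDerivAt l L x)
    (hu : HasDerivAt u L x) (h_lower : l ≤ g) (h_upper : g ≤ u) (h_eq : l x = u x) :
    HasDerivAt g L x := by
  have h_lx : l x = g x := le_antisymm (h_lower x) ((h_upper x).trans_eq h_eq.symm)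
  have h_ux : u x = g x := h_eq ▸ h_lx
  rw [hasDerivAt_iff_isLittleO] at hl hu ⊢
  refine (Asymptotics.IsBigO.of_norm_le fun y => ?_).trans_isLittleO (hl.norm_left.add hu.norm_left)
  rw [h_lx, h_ux]
  simp only [Real.norm_eq_abs]
  exact (abs_le_max_abs_abs (by gcongr; exact h_lower y) (by gcongr; exact h_upper y)).trans
    (max_le_add_of_nonneg (abs_nonneg _) (abs_nonneg _))

lemma two_mul_inner_le {r : ℝ} (hr : 0 < r) (a b : E) :
    2 * inner ℝ a b ≤ r * ‖a‖ ^ 2 + r⁻¹ * ‖b‖ ^ 2 := by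
  have h_sq : 0 ≤ r⁻¹ * ‖r • a - b‖ ^ 2 := by positivity
  rw [norm_sub_sq_real, norm_smul, real_inner_smul_left, Real.norm_of_nonneg hr.le] at h_sq
  field_simp at h_sq ⊢
  linarith

variable {G Γ : X → E}

lemma integrable_exp_mul (hw : MemLp w ⊤ m) {q : X → ℝ} (hq : Integrable q m) :
    Integrable (fun x => Real.exp (w x) * q x) m := by
  rw [← memLp_one_iff_integrable] at hq ⊢
  exact hq.mul (memLp_top_exp hw)

lemma two_mul_integral_inner_le (hw : MemLp w ⊤ m) (hG : MemLp G 2 m) (hΓ : MemLp Γ 2 m) :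
    2 * ∫ x, inner ℝ (G x) (Γ x) ∂m ≤
      (∫ x, Real.exp (w x) * ‖G x‖ ^ 2 ∂m) + ∫ x, Real.exp (-w x) * ‖Γ x‖ ^ 2 ∂m := by
  have hG_int := integrable_exp_mul hw (hG.integrable_norm_pow two_ne_zero)
  have hΓ_int : Integrable (fun x => Real.exp (-w x) * ‖Γ x‖ ^ 2) m :=
    integrable_exp_mul hw.neg (hΓ.integrable_norm_pow two_ne_zero)
  rw [← integral_const_mul, ← integral_add hG_int hΓ_int]
  refine integral_mono ((integrable_inner_of_memLp hG hΓ).const_mul 2) (hG_int.add hΓ_int)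
    fun x => ?_
  simpa only [Pi.neg_apply, Real.exp_neg] using two_mul_inner_le (Real.exp_pos (w x)) (G x) (Γ x)

lemma dirichlet_lower_bound (hw : MemLp w ⊤ m) (hG : MemLp G 2 m) (hΓ : MemLp Γ 2 m)
    (h_test : ∫ x, Real.exp (-w x) * inner ℝ (Γ x) (G x) ∂m = ∫ x, ‖G x‖ ^ 2 ∂m) :
    2 * (∫ x, ‖G x‖ ^ 2 ∂m) - ∫ x, Real.exp (-w x) * ‖G x‖ ^ 2 ∂m ≤
      ∫ x, Real.exp (-w x) * ‖Γ x‖ ^ 2 ∂m := by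
  have h_young := two_mul_integral_inner_le hw.neg hG (hΓ.smul (memLp_top_exp hw.neg) (r := 2))
  have h_sq (x : X) : Real.exp (w x) * ‖Real.exp (-w x) • Γ x‖ ^ 2 =
      Real.exp (-w x) * ‖Γ x‖ ^ 2 := by
    rw [norm_smul, Real.norm_eq_abs, Real.abs_exp, mul_pow, ← mul_assoc, sq (Real.exp _),
      ← mul_assoc, ← Real.exp_add, add_neg_cancel, Real.exp_zero, one_mul]
  simp only [Pi.smul_apply', Pi.neg_apply, real_inner_smul_left, neg_neg, h_sq,
    ← real_inner_comm (G _)] at h_young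
  rw [h_test] at h_young
  linarith

lemma thomson_upper_bound (hw : MemLp w ⊤ m) (hG : MemLp G 2 m) (hΓ : MemLp Γ 2 m)
    (h_test : ∫ x, Real.exp (-w x) * inner ℝ (Γ x) (Γ x) ∂m = ∫ x, inner ℝ (G x) (Γ x) ∂m) :
    ∫ x, Real.exp (-w x) * ‖Γ x‖ ^ 2 ∂m ≤ ∫ x, Real.exp (w x) * ‖G x‖ ^ 2 ∂m := by
  have h_young := two_mul_integral_inner_le hw hG hΓ
  simp only [real_inner_self_eq_norm_sq] at h_test
  linarith

/-- The Dirichlet and Thomson bounds agree to first order at `ε = 0`, which gives the derivative of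
the energy without any differentiation of `Γ`. -/
theorem hasDerivAt_energy (hδ : MemLp δ ⊤ m) (hG : MemLp G 2 m) {Γ : ℝ → X → E}
    (hΓ : ∀ ε, MemLp (Γ ε) 2 m)
    (h_test : ∀ ε, ∫ x, Real.exp (-(ε * δ x)) * inner ℝ (Γ ε x) (G x) ∂m = ∫ x, ‖G x‖ ^ 2 ∂m)
    (h_self : ∀ ε, ∫ x, Real.exp (-(ε * δ x)) * inner ℝ (Γ ε x) (Γ ε x) ∂m =
      ∫ x, inner ℝ (G x) (Γ ε x) ∂m) :
    HasDerivAt (fun ε => ∫ x, Real.exp (-(ε * δ x)) * ‖Γ ε x‖ ^ 2 ∂m)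
      (∫ x, δ x * ‖G x‖ ^ 2 ∂m) 0 := by
  have hG_int : Integrable (fun x => ‖G x‖ ^ 2) m := hG.integrable_norm_pow two_ne_zero
  have h_upper := hasDerivAt_integral_exp_mul hδ hG_int
  have h_lower := (hasDerivAt_integral_exp_mul hδ.neg hG_int).const_sub (2 * ∫ x, ‖G x‖ ^ 2 ∂m)
  simp only [Pi.neg_apply, neg_mul, mul_neg, integral_neg, neg_neg] at h_lower
  refine hasDerivAt_of_le_of_le h_lower h_upper
    (fun ε => dirichlet_lower_bound (hδ.const_mul ε) hG (hΓ ε) (h_test ε))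
    (fun ε => thomson_upper_bound (hδ.const_mul ε) hG (hΓ ε) (h_self ε)) ?_
  simp only [zero_mul, neg_zero, Real.exp_zero, one_mul]
  ring

end Energy

/-! ### The asymptotic variance -/

lemma HasDirDeriv.of_hasDerivAt {E : (Sp d → ℝ) → ℝ} {U δ : Sp d → ℝ} {L : ℝ}
    (h : HasDerivAt (fun ε : ℝ => E (U + ε • δ)) L 0) : HasDirDeriv E U δ L := by
  simpa only [HasDirDeriv, one_div, zero_add, zero_smul, add_zero, smul_eq_mul] using
    hasDerivAt_iff_tendsto_slope_zero.1 h

section AsymptoticVariance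

variable {D : Dom} {V f U δ w : Sp d → ℝ} {φ φ' : Sp d → ℝ} {G G' : Sp d → Sp d}

lemma IsPoissonSol.asymVar_eq (hφ : IsPoissonSol D V f U φ G) (h : PoissonData D V f U) :
    asymVar D V f U =
      2 * Zc D (V + U) ^ 2 / Zc D V ^ 2 * ∫ x, ‖G x‖ ^ 2 ∂(gibbs D (V + U)) := by
  have h_exists : ∃ G φ, IsPoissonSol D V f U φ G := ⟨G, φ, hφ⟩
  obtain ⟨φ', hφ'⟩ : ∃ φ', IsPoissonSol D V f U φ' (poissonGrad D V f U) := by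
    rw [poissonGrad, dif_pos h_exists]
    exact h_exists.choose_spec
  have h_grad := (gibbs_absolutelyContinuous D (V + U)).ae_eq (hφ.ae_eq hφ' h).2
  rw [asymVar, integral_congr_ae (h_grad.mono fun x hx => congrArg (‖·‖ ^ 2) hx)]

lemma IsPoissonSol.asymVar_add_eq (hφ' : IsPoissonSol D V f (U + w) φ' G')
    (h : PoissonData D V f U) (hw : IsBddCont D w) :
    asymVar D V f (U + w) = 2 * Zc D (V + U) ^ 2 / Zc D V ^ 2 *
      ((∫ x, Real.exp (-w x) ∂(gibbs D (V + U))) *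
        ∫ x, Real.exp (-w x) * ‖G' x‖ ^ 2 ∂(gibbs D (V + U))) := by
  have hWw := h.biased.add hw
  have h_Zc := Zc_add h.biased hWw
  have h_energy := Zc_add_mul_integral_gibbs h.biased hWw fun x => ‖G' x‖ ^ 2
  rw [hφ'.asymVar_eq (h.perturb hw), ← add_assoc]
  linear_combination 2 / Zc D V ^ 2 * (Zc D (V + U + w) * h_energy + Zc D (V + U) *
    (∫ x, Real.exp (-w x) * ‖G' x‖ ^ 2 ∂(gibbs D (V + U))) * h_Zc)

theorem IsPoissonSol.hasDerivAt_energy (hφ : IsPoissonSol D V f U φ G) (h : PoissonData D V f U)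
    (hδ : IsBddCont D δ) {Φ : ℝ → Sp d → ℝ} {Γ : ℝ → Sp d → Sp d}
    (hΦ : ∀ ε, IsPoissonSol D V f (U + ε • δ) (Φ ε) (Γ ε)) :
    HasDerivAt (fun ε => ∫ x, Real.exp (-(ε * δ x)) * ‖Γ ε x‖ ^ 2 ∂(gibbs D (V + U)))
      (∫ x, δ x * ‖G x‖ ^ 2 ∂(gibbs D (V + U))) 0 := by
  have hΦ_memH1 (ε : ℝ) : MemH1 D (gibbs D (V + U)) (Φ ε) (Γ ε) :=
    (memH1_gibbs_add_iff h.biased (hδ.const_smul ε)).1 (add_assoc V U _ ▸ (hΦ ε).memH1)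
  refine AsymVar.hasDerivAt_energy (hδ.memLp_top _) hφ.memH1.memLp_grad
    (fun ε => (hΦ_memH1 ε).memLp_grad) (fun ε => ?_)
    fun ε => hφ.integral_exp_mul_inner h (hδ.const_smul ε) (hΦ ε) (hΦ_memH1 ε)
  simpa only [real_inner_self_eq_norm_sq] using!
    hφ.integral_exp_mul_inner h (hδ.const_smul ε) (hΦ ε) hφ.memH1

theorem IsPoissonSol.hasDirDeriv_asymVar (hφ : IsPoissonSol D V f U φ G)
    (h : PoissonData D V f U) (hδ : IsBddCont D δ) :
    HasDirDeriv (asymVar D V f) U δ (2 * Zc D (V + U) ^ 2 / Zc D V ^ 2 *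
      ∫ x, δ x * (‖G x‖ ^ 2 - ∫ y, ‖G y‖ ^ 2 ∂(gibbs D (V + U))) ∂(gibbs D (V + U))) := by
  have := h.biased.isProbabilityMeasure
  choose Φ Γ hΦ _ using fun ε : ℝ => (h.perturb (hδ.const_smul ε)).poissonWellPosed
  have h_zero : ∫ x, Real.exp (-(0 * δ x)) * ‖Γ 0 x‖ ^ 2 ∂(gibbs D (V + U)) =
      ∫ x, ‖G x‖ ^ 2 ∂(gibbs D (V + U)) := by
    have hΦ₀ : IsPoissonSol D V f U (Φ 0) (Γ 0) := by simpa only [zero_smul, add_zero] using hΦ 0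
    have h_grad := (gibbs_absolutelyContinuous D (V + U)).ae_eq (hφ.ae_eq hΦ₀ h).2
    simp only [zero_mul, neg_zero, Real.exp_zero, one_mul]
    exact integral_congr_ae (h_grad.mono fun x hx => congrArg (‖·‖ ^ 2) hx)
  have h_mass := hasDerivAt_integral_exp_mul (hδ.memLp_top (gibbs D (V + U))).neg
    (integrable_const 1)
  simp only [Pi.neg_apply, mul_neg, mul_one, integral_neg] at h_mass
  have h_prod := (h_mass.mul (hφ.hasDerivAt_energy h hδ hΦ)).const_mul
    (2 * Zc D (V + U) ^ 2 / Zc D V ^ 2)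
  refine .of_hasDerivAt ((h_prod.congr_deriv ?_).congr_of_eventuallyEq
    (.of_forall fun ε => (hΦ ε).asymVar_add_eq h (hδ.const_smul ε)))
  have h_energy_int : Integrable (fun x => ‖G x‖ ^ 2) (gibbs D (V + U)) :=
    hφ.memH1.memLp_grad.integrable_norm_pow two_ne_zero
  have hδ_top := hδ.memLp_top (gibbs D (V + U))
  have hδG_int : Integrable (fun x => δ x * ‖G x‖ ^ 2) (gibbs D (V + U)) :=
    memLp_one_iff_integrable.1 ((memLp_one_iff_integrable.2 h_energy_int).mul hδ_top)
  simp only [mul_sub (δ _)]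
  rw [integral_sub hδG_int ((hδ_top.integrable le_top).mul_const _), integral_mul_const, h_zero]
  simp only [zero_mul, neg_zero, Real.exp_zero, integral_const, probReal_univ, smul_eq_mul]
  ring

end AsymptoticVariance

end AsymVar

end

theorem mainTheorem3_general {d : ℕ} {D : AsymVar.Dom} {V f U δU : AsymVar.Sp d → ℝ}
    (h : AsymVar.PoissonData D V f U) (hδU : AsymVar.IsBddCont D δU) :
    (∀ ε : ℝ, AsymVar.PoissonWellPosed D V f (U + ε • δU)) ∧
    ∀ (φ : AsymVar.Sp d → ℝ) (G : AsymVar.Sp d → AsymVar.Sp d),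
      AsymVar.IsPoissonSol D V f U φ G →
      ∃ L : ℝ, AsymVar.HasDirDeriv (AsymVar.asymVar D V f) U δU L ∧
        1 / 2 * L =
          AsymVar.Zc D (V + U) ^ 2 / AsymVar.Zc D V ^ 2 *
            ∫ x, δU x * (‖G x‖ ^ 2 - ∫ y, ‖G y‖ ^ 2 ∂(AsymVar.gibbs D (V + U)))
              ∂(AsymVar.gibbs D (V + U)) :=
  ⟨fun ε => (h.perturb (hδU.const_smul ε)).poissonWellPosed,
    fun _ _ hφ => ⟨_, hφ.hasDirDeriv_asymVar h hδU, by ring⟩⟩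

theorem mainTheorem3 (d : ℕ) (D : AsymVar.Dom) (V f : AsymVar.Sp d → ℝ)
    (hVf : AsymVar.Standing D V f)
    (U : AsymVar.Sp d → ℝ) (hU : AsymVar.Admissible D V f U)
    (δU : AsymVar.Sp d → ℝ) (hδU : AsymVar.IsTest D δU) :
    (∀ ε : ℝ, AsymVar.PoissonWellPosed D V f (U + ε • δU)) ∧
    ∀ (φ : AsymVar.Sp d → ℝ) (G : AsymVar.Sp d → AsymVar.Sp d),
      AsymVar.IsPoissonSol D V f U φ G →
      ∃ L : ℝ, AsymVar.HasDirDeriv (AsymVar.asymVar D V f) U δU L ∧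
        1 / 2 * L =
          AsymVar.Zc D (V + U) ^ 2 / AsymVar.Zc D V ^ 2 *
            ∫ x, δU x * (‖G x‖ ^ 2 - ∫ y, ‖G y‖ ^ 2 ∂(AsymVar.gibbs D (V + U)))
              ∂(AsymVar.gibbs D (V + U)) := by
  exact mainTheorem3_general (hU.poissonData hVf) hδU.isBddCont
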